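/- For vectors $c^j\in\mathbb Q^{n_j}$, $j\in[s]$, let $c^1\otimes\cdots\otimes c^s$ be the $n_1\times\cdots\times n_s$ tensor with entries $\prod_{j\in[s]}c^j_{k_j}$. The *rank* of a rational tensor is the least $r$ such that it is a sum of $r$ tensors of this form. The *Boolean rank* of a tensor is the least $r$ such that it is the component-wise disjunction of $r$ tensors $c^1\otimes\cdots\otimes c^s$ with all $c^j\in\{0,1\}^{n_j}$. In the *rank-1 Boolean tensor factorization problem* we are given an $n_1\times\cdots\times n_s$ rational tensor $A=(a_{k_1,\dots,k_s})$ (with $n_1,\dots,n_s\ge 1$), and we look for $x^j\in\{0,1\}^{n_j}$, $j\in[s]$, such that $B=x^1\otimes\cdots\otimes x^s$ has Boolean rank $1$ and minimizes $$\sum_{k_1\in[n_1]}\cdots\sum_{k_s\in[n_s]}\bigl(a_{k_1,\dots,k_s}-b_{k_1,\dots,k_s}\bigr)^2$$ over all tensors $B=(b_{k_1,\dots,k_s})$ of Boolean rank $1$. In the variant with the zero tensor admitted, "Boolean rank $1$" is replaced by "Boolean rank at most $1$" throughout. **Statement.** Fix integers $s\ge 1$ and $q\ge 0$. Both the rank-1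 Boolean tensor factorization problem and its variant with the zero tensor admitted can be solved in strongly polynomial time when the input tensor is given, through vectors $a^{p,j}\in\mathbb Q^{n_j}$ ($p\in[q]$, $j\in[s]$), as $$A=\sum_{p\in[q]}a^{p,1}\otimes a^{p,2}\otimes\cdots\otimes a^{p,s}.$$ In particular, this holds when $A$ has fixed rank $q$ and the given factorization is a rank factorization. Here, solvable in strongly polynomial time means that there is one algorithm (depending only on $s$ and $q$, using additions, subtractions, multiplications, divisions and comparisons of rational numbers, together with additions, truncated subtractions, multiplications and comparisons of natural-number counters and addresses) that solves every instance such that the number of elementary operations is at most a polynomial in the number of input data (a dimension $n_j$ counting as $n_j+1$ data), and the binary encoding length of every number produced is at most a polynomial in the encoding length of the input (a dimension $n_j$ again counting as $n_j+1$). -/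

import Mathlib

/-! ### The machine model

A random access machine over the rationals.  A state has index registers holding natural numbers
(used for loop counters and addresses) and arrays of rational numbers.  A program mentions only
finitely many registers and arrays.  Rational numbers influence the control flow only through
comparisons, and rounding is not available. -/

namespace StrongPoly

/-- A state of the machine: `idx i` is the content of the `i`-th index register and `mem a k` is the
`k`-th entry of the array `a` of rational numbers. -/
structure State where
  idx : ℕ → ℕ
  mem : ℕ → ℕ → ℚ

/-- The elementary arithmetic operations on index registers (subtraction is truncated). -/
inductive IdxOp
  | add
  | sub
  | mul

def IdxOp.apply : IdxOp → ℕ → ℕ → ℕ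
  | .add, x, y => x + y
  | .sub, x, y => x - y
  | .mul, x, y => x * y

/-- The elementary arithmetic operations on rational numbers. -/
inductive RatOp
  | add
  | sub
  | mul
  | div

def RatOp.apply : RatOp → ℚ → ℚ → ℚ
  | .add, x, y => x + y
  | .sub, x, y => x - y
  | .mul, x, y => x * y
  | .div, x, y => x / y

/-- The elementary instructions.  Here `i j k` name index registers and `a b c` name arrays;
array entries are addressed through the contents of index registers. -/
inductive Instr
  /-- `idx i := v` -/
  | idxConst (i v : ℕ)
  /-- `idx i := idx j op idx k` -/
  | idxArith (op : IdxOp) (i j k : ℕ)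
  /-- `mem a (idx i) := v` -/
  | ratConst (a i : ℕ) (v : ℚ)
  /-- `mem a (idx i) := mem b (idx j) op mem c (idx k)` -/
  | ratArith (op : RatOp) (a i b j c k : ℕ)

/-- The encoding length of a natural number: the number of its binary digits. -/
def natSize (n : ℕ) : ℕ := Nat.size n

/-- The encoding length of a rational number: a sign, numerator and denominator in binary. -/
def ratSize (x : ℚ) : ℕ := 1 + Nat.size x.num.natAbs + Nat.size x.den

def State.setIdx (σ : State) (i v : ℕ) : State :=
  { σ with idx := Function.update σ.idx i v }

def State.setMem (σ : State) (a k : ℕ) (v : ℚ) : State :=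
  { σ with mem := Function.update σ.mem a (Function.update (σ.mem a) k v) }

/-- The state after an instruction. -/
def Instr.apply : Instr → State → State
  | .idxConst i v, σ => σ.setIdx i v
  | .idxArith op i j k, σ => σ.setIdx i (op.apply (σ.idx j) (σ.idx k))
  | .ratConst a i v, σ => σ.setMem a (σ.idx i) v
  | .ratArith op a i b j c k, σ =>
      σ.setMem a (σ.idx i) (op.apply (σ.mem b (σ.idx j)) (σ.mem c (σ.idx k)))

/-- The encoding length of the number that an instruction produces. -/
def Instr.outSize : Instr → State → ℕ
  | .idxConst _ v, _ => natSize v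
  | .idxArith op _ j k, σ => natSize (op.apply (σ.idx j) (σ.idx k))
  | .ratConst _ _ v, _ => ratSize v
  | .ratArith op _ _ b j c k, σ => ratSize (op.apply (σ.mem b (σ.idx j)) (σ.mem c (σ.idx k)))

/-- The elementary comparisons. -/
inductive Test
  /-- `idx i < idx j` -/
  | idxLt (i j : ℕ)
  /-- `mem a (idx i) < mem b (idx j)` -/
  | ratLt (a i b j : ℕ)

def Test.Holds : Test → State → Prop
  | .idxLt i j, σ => σ.idx i < σ.idx j
  | .ratLt a i b j, σ => σ.mem a (σ.idx i) < σ.mem b (σ.idx j)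

/-- Programs. -/
inductive Prog
  | instr (I : Instr)
  | seq (P Q : Prog)
  | ite (c : Test) (P Q : Prog)
  | loop (c : Test) (P : Prog)

/-- `Exec b P σ t τ`: started in the state `σ`, the program `P` halts in the state `τ` after exactly
`t` elementary operations (instructions and comparisons), and every number produced on the way has
encoding length at most `b`. -/
inductive Exec (b : ℕ) : Prog → State → ℕ → State → Prop
  | instr (I : Instr) (σ : State) (h : I.outSize σ ≤ b) : Exec b (.instr I) σ 1 (I.apply σ)
  | seq {P Q : Prog} {σ τ υ : State} {t u : ℕ} (hP : Exec b P σ t τ) (hQ : Exec b Q τ u υ) :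
      Exec b (.seq P Q) σ (t + u) υ
  | iteTrue {c : Test} {P Q : Prog} {σ τ : State} {t : ℕ} (hc : c.Holds σ)
      (hP : Exec b P σ t τ) : Exec b (.ite c P Q) σ (t + 1) τ
  | iteFalse {c : Test} {P Q : Prog} {σ τ : State} {t : ℕ} (hc : ¬ c.Holds σ)
      (hQ : Exec b Q σ t τ) : Exec b (.ite c P Q) σ (t + 1) τ
  | loopDone {c : Test} {P : Prog} {σ : State} (hc : ¬ c.Holds σ) : Exec b (.loop c P) σ 1 σ
  | loopStep {c : Test} {P : Prog} {σ τ υ : State} {t u : ℕ} (hc : c.Holds σ)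
      (hP : Exec b P σ t τ) (hL : Exec b (.loop c P) τ u υ) :
      Exec b (.loop c P) σ (t + u + 1) υ

/-- An input: a list of dimensions and a list of rational vectors. -/
structure Input where
  dims : List ℕ
  vecs : List (List ℚ)

/-- The number of data in the input; a dimension `n` counts as `n + 1`, since it stands for a set of
`n` coordinates. -/
def Input.count (x : Input) : ℕ :=
  (x.dims.map fun n => n + 1).sum + (x.vecs.map List.length).sum

/-- The encoding length of the input (with the dimensions counted as in `Input.count`). -/
def Input.size (x : Input) : ℕ :=
  (x.dims.map fun n => n + 1).sum + (x.vecs.map fun v => (v.map ratSize).sum).sum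

/-- The initial state on a given input: the `i`-th dimension is in the `i`-th index register, the
`a`-th vector is in the array `a`, and everything else is zero. -/
def Input.start (x : Input) : State where
  idx i := x.dims.getD i 0
  mem a k := (x.vecs.getD a []).getD k 0

/-- A computational problem with instances `ι`, presented to the machine by `enc`, where
`Correct x m` says that the final contents `m` of the arrays are a correct answer for `x`, is
solvable in strongly polynomial time: one program answers all instances correctly, with a number of
elementary operations that is polynomial in the number of input data, and with all numbers produced
on the way of encoding length polynomial in the encoding length of the input. -/
def SolvableInStronglyPolynomialTime {ι : Type} (enc : ι → Input)
    (Correct : ι → (ℕ → ℕ → ℚ) → Prop) : Prop :=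
  ∃ (P : Prog) (T B : Polynomial ℕ), ∀ x : ι, ∃ (t : ℕ) (τ : State),
    Exec (B.eval (enc x).size) P (enc x).start t τ ∧
      t ≤ T.eval (enc x).count ∧ Correct x τ.mem

end StrongPoly

/-! ### Tensors, rank and Boolean rank -/

namespace BoolTensor

/-- Rational `n 0 × n 1 × ⋯ × n (s - 1)` tensors. -/
abbrev Tensor {s : ℕ} (n : Fin s → ℕ) : Type := (∀ j, Fin (n j)) → ℚ

variable {s : ℕ} {n : Fin s → ℕ}

/-- The outer product `c 0 ⊗ c 1 ⊗ ⋯ ⊗ c (s - 1)`. -/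
def outer (c : ∀ j, Fin (n j) → ℚ) : Tensor n := fun k => ∏ j, c j (k j)

/-- All components of all the vectors `c j` are `0` or `1`. -/
def IsBinary (c : ∀ j, Fin (n j) → ℚ) : Prop := ∀ j k, c j k = 0 ∨ c j k = 1

/-- `A` is a sum of `r` outer products. -/
def HasFactorization (A : Tensor n) (r : ℕ) : Prop :=
  ∃ c : Fin r → ∀ j, Fin (n j) → ℚ, A = ∑ i, outer (c i)

/-- The rank of `A` is `r`. -/
def HasRank (A : Tensor n) (r : ℕ) : Prop := IsLeast {r' | HasFactorization A r'} r

open Classical in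
/-- The componentwise "or" of a family of tensors with entries in `{0, 1}`. -/
noncomputable def disj {r : ℕ} (D : Fin r → Tensor n) : Tensor n :=
  fun k => if ∃ i, D i k = 1 then 1 else 0

/-- `B` is the componentwise "or" of `r` outer products of binary vectors. -/
def HasBooleanFactorization (B : Tensor n) (r : ℕ) : Prop :=
  ∃ c : Fin r → ∀ j, Fin (n j) → ℚ, (∀ i, IsBinary (c i)) ∧ B = disj fun i => outer (c i)

/-- The Boolean rank of `B` is `r`. -/
def HasBooleanRank (B : Tensor n) (r : ℕ) : Prop :=
  IsLeast {r' | HasBooleanFactorization B r'} r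

/-- The Boolean rank of `B` is at most `r`. -/
def HasBooleanRankAtMost (B : Tensor n) (r : ℕ) : Prop :=
  ∃ r' ≤ r, HasBooleanRank B r'

/-- The sum of the squares of the entries of `A - B`. -/
def sqError (A B : Tensor n) : ℚ := ∑ k, (A k - B k) ^ 2

/-- `B` is a best approximation of `A` among the tensors in `S`. -/
def IsBestApprox (S : Set (Tensor n)) (A B : Tensor n) : Prop :=
  B ∈ S ∧ ∀ B' ∈ S, sqError A B ≤ sqError A B'

/-- A tensor of order `s` given as a sum of `q` outer products: positive dimensions `n j` and the
vectors `a p j` of dimension `n j`. -/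
structure Factorized (s q : ℕ) where
  n : Fin s → ℕ
  n_pos : ∀ j, 0 < n j
  a : Fin q → ∀ j, Fin (n j) → ℚ

namespace Factorized

variable {q : ℕ}

/-- The tensor that is given by the factorization. -/
def tensor (F : Factorized s q) : Tensor F.n := ∑ p, outer (F.a p)

/-- The given factorization is a rank factorization. -/
def IsRankFactorization (F : Factorized s q) : Prop := HasRank F.tensor q

/-- The input to the machine: the dimensions, and the vectors in the order
`a 0 0, …, a 0 (s - 1), a 1 0, …`; so `a p j` is in the array `p * s + j`. -/
def input (F : Factorized s q) : StrongPoly.Input where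
  dims := List.ofFn F.n
  vecs := List.ofFn fun m : Fin (q * s) => List.ofFn (F.a m.divNat m.modNat)

/-- The vectors of dimensions `n 0, …, n (s - 1)` that are read off the arrays `0, …, s - 1`. -/
def readOff (F : Factorized s q) (m : ℕ → ℕ → ℚ) : ∀ j, Fin (F.n j) → ℚ := fun j k => m j k

/-- A correct answer: the arrays `0, …, s - 1` hold binary vectors whose outer product is
a best approximation of the given tensor among the tensors of Boolean rank `1`. -/
def Solved (F : Factorized s q) (m : ℕ → ℕ → ℚ) : Prop :=
  IsBinary (F.readOff m) ∧
    IsBestApprox {B | HasBooleanRank B 1} F.tensor (outer (F.readOff m))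

/-- The variant of `Solved` in which the zero tensor (of Boolean rank `0`) is admitted as well. -/
def SolvedAtMost (F : Factorized s q) (m : ℕ → ℕ → ℚ) : Prop :=
  IsBinary (F.readOff m) ∧
    IsBestApprox {B | HasBooleanRankAtMost B 1} F.tensor (outer (F.readOff m))

end Factorized

end BoolTensor

namespace StrongPoly

/-! ### Frames, cost and a program logic -/

/-! A tensor `B` with entries 0 and 1 satisfies `B² = B` entrywise, so its squared distance from `A`
is a constant plus the sum of the entries of `B` minus twice the inner product of `A` and `B`. If
`B` is an outer product of binary vectors `x j` and `A` is a sum of `q` outer products, both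
quantities are sums of products of linear forms in the `x j`. Thus the error is, up to a constant,
an `objective` with `d = q + 1` terms, where the additional term comes from all-ones vectors
(`Factorized.sqError_eq`).

With all vectors but `x j` fixed, the objective is linear in `x j`, and the coefficient of the
`k`-th entry is the value of one linear form on `ℚ^d` at the point `(v j p k)ₚ`
(`objective_update`). A best `x j` is therefore governed by the signs of a linear form at the given
points. For fixed `d` only polynomially many sign patterns occur, and they can be listed without
knowledge of the form.

The list comes from `exists_pattern`. Let `L` be the values of the form and `u` the current
coordinate. Choose `κ` with `u κ ≠ 0` and `|L κ / u κ|` minimal, and subtract `θ u` from `L`, where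
`θ = L κ / u κ`. No sign of `L` is reversed, and where the difference vanishes, the sign of `L` is
that of `θ u`. The difference is a linear form in the remaining coordinates after their elimination
at `κ`, and the coefficient of `u` has dropped out. After `d` rounds nothing of the form is left, so
the pattern is determined by `d` pivots and the `d` signs of the numbers `θ`.

To exclude the zero vector, one entry of a pattern is set to 1 (`exists_candidate_le`). Replacing
the vectors one at a time shows that candidates attain the optimum (`exists_candidates_le`). Nested
loops over all pivots, signs and special entries find it; if zero is admitted, the optimal value is
finally compared with 0, the objective of the zero tensor.

On the machine the nesting depth depends only on `s` and `q`, and every loop has at most `N` rounds,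
so `Prog.cost` is a polynomial in `N`. Every rational number produced arises by a bounded number of
operations from data and sums of at most `M` products, which `grow` measures. -/

def Instr.KeepsReg (r : ℕ) : Instr → Prop
  | .idxConst i _ => r ≠ i
  | .idxArith _ i _ _ => r ≠ i
  | .ratConst _ _ _ => True
  | .ratArith _ _ _ _ _ _ _ => True

def Instr.Avoids (a : ℕ) : Instr → Prop
  | .idxConst _ _ => True
  | .idxArith _ _ _ _ => True
  | .ratConst a' _ _ => a ≠ a'
  | .ratArith _ a' _ _ _ _ _ => a ≠ a'

/-- No instruction of the program writes to the index register `r`. -/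
def Prog.KeepsReg (r : ℕ) : Prog → Prop
  | .instr I => I.KeepsReg r
  | .seq P Q => P.KeepsReg r ∧ Q.KeepsReg r
  | .ite _ P Q => P.KeepsReg r ∧ Q.KeepsReg r
  | .loop _ P => P.KeepsReg r

/-- No instruction of the program writes to the array `a`. -/
def Prog.Avoids (a : ℕ) : Prog → Prop
  | .instr I => I.Avoids a
  | .seq P Q => P.Avoids a ∧ Q.Avoids a
  | .ite _ P Q => P.Avoids a ∧ Q.Avoids a
  | .loop _ P => P.Avoids a

/-- The registers and arrays that the program does not write to have the same contents. -/
structure Frame (P : Prog) (σ τ : State) : Prop where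
  idx : ∀ r, P.KeepsReg r → τ.idx r = σ.idx r
  mem : ∀ a, P.Avoids a → τ.mem a = σ.mem a

theorem Frame.refl (P : Prog) (σ : State) : Frame P σ σ := ⟨fun _ _ => rfl, fun _ _ => rfl⟩

theorem Frame.trans {P : Prog} {σ τ υ : State} (h : Frame P σ τ) (h' : Frame P τ υ) :
    Frame P σ υ :=
  ⟨fun r hr => (h'.idx r hr).trans (h.idx r hr), fun a ha => (h'.mem a ha).trans (h.mem a ha)⟩

theorem Instr.frame (I : Instr) (σ : State) : Frame (.instr I) σ (I.apply σ) := by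
  constructor
  · intro r hr
    cases I <;> simp_all [Prog.KeepsReg, Instr.KeepsReg, Instr.apply, State.setIdx, State.setMem]
  · intro r hr
    cases I <;> simp_all [Prog.Avoids, Instr.Avoids, Instr.apply, State.setIdx, State.setMem]

/-- An instruction names the register or array it writes to, even where the address within the array
is computed. What stays unchanged can thus be read off the program text, and invariants need to
mention only what a program changes. -/
theorem Exec.frame {b : ℕ} {P : Prog} {σ τ : State} {t : ℕ} (h : Exec b P σ t τ) :
    Frame P σ τ := by
  induction h with
  | instr I σ _ => exact I.frame σ
  | seq _ _ h₁ h₂ =>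
    exact ⟨fun r hr => (h₂.idx r hr.2).trans (h₁.idx r hr.1),
      fun a ha => (h₂.mem a ha.2).trans (h₁.mem a ha.1)⟩
  | iteTrue _ _ h => exact ⟨fun r hr => h.idx r hr.1, fun a ha => h.mem a ha.1⟩
  | iteFalse _ _ h => exact ⟨fun r hr => h.idx r hr.2, fun a ha => h.mem a ha.2⟩
  | loopDone _ => exact Frame.refl _ _
  | loopStep _ _ _ h₁ h₂ =>
    exact ⟨fun r hr => (h₂.idx r hr).trans (h₁.idx r hr),
      fun a ha => (h₂.mem a ha).trans (h₁.mem a ha)⟩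

/-- A bound for the running time if every loop makes at most `N` rounds. -/
def Prog.cost (N : ℕ) : Prog → ℕ
  | .instr _ => 1
  | .seq P Q => P.cost N + Q.cost N
  | .ite _ P Q => P.cost N + Q.cost N + 1
  | .loop _ P => N * (P.cost N + 1) + 1

/-- The cost of a program as a polynomial. -/
noncomputable def Prog.costPoly : Prog → Polynomial ℕ
  | .instr _ => 1
  | .seq P Q => P.costPoly + Q.costPoly
  | .ite _ P Q => P.costPoly + Q.costPoly + 1
  | .loop _ P => Polynomial.X * (P.costPoly + 1) + 1

theorem Prog.eval_costPoly (P : Prog) (N : ℕ) : P.costPoly.eval N = P.cost N := by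
  induction P <;> simp_all [Prog.costPoly, Prog.cost]

/-- Started in `σ`, the program halts in a state with the property `Post`; every number produced has
encoding length at most `b`, and the time is as if every loop made at most `N` rounds. -/
def Runs (b N : ℕ) (P : Prog) (σ : State) (Post : State → Prop) : Prop :=
  ∃ t τ, Exec b P σ t τ ∧ t ≤ P.cost N ∧ Post τ

variable {b N : ℕ}

theorem Runs.imp {P : Prog} {σ : State} {Post Post' : State → Prop} (h : Runs b N P σ Post)
    (h' : ∀ τ, Post τ → Frame P σ τ → Post' τ) : Runs b N P σ Post' := by
  obtain ⟨t, τ, h, ht, hτ⟩ := h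
  exact ⟨t, τ, h, ht, h' τ hτ h.frame⟩

theorem Runs.instr {I : Instr} {σ : State} {Post : State → Prop} (h : I.outSize σ ≤ b)
    (hp : Post (I.apply σ)) : Runs b N (.instr I) σ Post :=
  ⟨1, _, .instr I σ h, le_rfl, hp⟩

theorem Runs.seq {P Q : Prog} {σ : State} {Mid Post : State → Prop} (h : Runs b N P σ Mid)
    (h' : ∀ τ, Mid τ → Frame P σ τ → Runs b N Q τ Post) : Runs b N (.seq P Q) σ Post := by
  obtain ⟨t, τ, h, ht, hτ⟩ := h
  obtain ⟨u, υ, hu, hut, hυ⟩ := h' τ hτ h.frame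
  exact ⟨t + u, υ, .seq h hu, Nat.add_le_add ht hut, hυ⟩

theorem Runs.ite {c : Test} {P Q : Prog} {σ : State} {Post : State → Prop}
    (h : c.Holds σ → Runs b N P σ Post) (h' : ¬ c.Holds σ → Runs b N Q σ Post) :
    Runs b N (.ite c P Q) σ Post := by
  by_cases hc : c.Holds σ
  · obtain ⟨t, τ, h, ht, hτ⟩ := h hc
    exact ⟨t + 1, τ, .iteTrue hc h, by simp only [Prog.cost]; omega, hτ⟩
  · obtain ⟨t, τ, h, ht, hτ⟩ := h' hc
    exact ⟨t + 1, τ, .iteFalse hc h, by simp only [Prog.cost]; omega, hτ⟩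

/-- The invariant is indexed by the number of completed rounds and decides the test, so there are
exactly `n` rounds. The proof is by induction on the number of rounds that remain. -/
theorem Runs.loop {c : Test} {P : Prog} {σ : State} (Inv : ℕ → State → Prop) {n : ℕ} (hn : n ≤ N)
    (hc : ∀ i σ, Inv i σ → (c.Holds σ ↔ i < n)) (h₀ : Inv 0 σ)
    (h : ∀ i < n, ∀ σ, Inv i σ → Runs b N P σ (Inv (i + 1))) :
    Runs b N (.loop c P) σ (Inv n) := by
  have key : ∀ m i σ, i + m = n → Inv i σ →
      ∃ t τ, Exec b (.loop c P) σ t τ ∧ t ≤ m * (P.cost N + 1) + 1 ∧ Inv n τ := by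
    intro m
    induction m with
    | zero =>
      intro i σ hi hσ
      obtain rfl : i = n := by omega
      exact ⟨1, σ, .loopDone (by rw [hc i σ hσ]; omega), by omega, hσ⟩
    | succ m ih =>
      intro i σ hi hσ
      obtain ⟨t, τ, ht, htc, hτ⟩ := h i (by omega) σ hσ
      obtain ⟨u, υ, hu, huc, hυ⟩ := ih (i + 1) τ (by omega) hτ
      exact ⟨t + u + 1, υ, .loopStep ((hc i σ hσ).2 (by omega)) ht hu, by
        rw [Nat.succ_mul]; omega, hυ⟩
  obtain ⟨t, τ, ht, htc, hτ⟩ := key n 0 σ (by omega) h₀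
  refine ⟨t, τ, ht, htc.trans ?_, hτ⟩
  simp only [Prog.cost]
  gcongr

/-- `for r := 0, …, idx B - 1 do P`, where the register `o` contains `1`. -/
def forLt (o r B : ℕ) (P : Prog) : Prog :=
  .seq (.instr (.idxConst r 0))
    (.loop (.idxLt r B) (.seq P (.instr (.idxArith .add r r o))))

/-- This crude bound suffices for counters, since a dimension `n` contributes `n + 1` to the
encoding length of the input. -/
theorem natSize_le_self (n : ℕ) : natSize n ≤ n := Nat.size_le.2 Nat.lt_two_pow_self

/-! ### Updates of states and rules for counted loops -/

theorem setIdx_idx (σ : State) (i v r : ℕ) :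
    (σ.setIdx i v).idx r = if r = i then v else σ.idx r := by
  simp [State.setIdx, Function.update_apply]

theorem setIdx_mem (σ : State) (i v : ℕ) : (σ.setIdx i v).mem = σ.mem := rfl

theorem setMem_idx (σ : State) (a k : ℕ) (v : ℚ) : (σ.setMem a k v).idx = σ.idx := rfl

theorem setMem_mem (σ : State) (a k : ℕ) (v : ℚ) (a' k' : ℕ) :
    (σ.setMem a k v).mem a' k' = if a' = a ∧ k' = k then v else σ.mem a' k' := by
  by_cases h : a' = a
  · subst h; simp [State.setMem, Function.update_apply]
  · simp [State.setMem, h]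

theorem setMem_mem_of_ne (σ : State) {a k : ℕ} {v : ℚ} {a' : ℕ} (h : a' ≠ a) :
    (σ.setMem a k v).mem a' = σ.mem a' := by
  simp [State.setMem, h]

/-- The body receives a `Frame` back to the state before the whole loop, so `Inv` can be silent
about everything the loop does not write. Here `N` limits the rounds and `b` the values of the
counter. -/
theorem Runs.forLt {o r B : ℕ} {P : Prog} {σ : State} (Inv : ℕ → State → Prop) {n : ℕ}
    (hN : n ≤ N) (hb : n ≤ b) (ho : σ.idx o = 1) (hB : σ.idx B = n) (hro : o ≠ r) (hrB : B ≠ r)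
    (kr : P.KeepsReg r) (ko : P.KeepsReg o) (kB : P.KeepsReg B) (h₀ : Inv 0 (σ.setIdx r 0))
    (h : ∀ i < n, ∀ σ', Inv i σ' → σ'.idx r = i → Frame (forLt o r B P) σ σ' →
      Runs b N P σ' fun τ => Inv (i + 1) (τ.setIdx r (i + 1))) :
    Runs b N (forLt o r B P) σ fun τ => Inv n τ ∧ τ.idx r = n := by
  have fr0 : Frame (StrongPoly.forLt o r B P) σ (σ.setIdx r 0) := by
    refine ⟨fun r' hr' => ?_, fun a _ => rfl⟩
    have : r' ≠ r := hr'.1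
    simp [setIdx_idx, this]
  refine Runs.seq (Mid := fun τ => τ = σ.setIdx r 0) (Runs.instr (by simp [Instr.outSize, natSize])
    rfl) ?_
  rintro _ rfl -
  refine (Runs.loop (fun i τ => Inv i τ ∧ τ.idx r = i ∧ Frame (StrongPoly.forLt o r B P) σ τ) hN
    ?_ ⟨h₀, by simp [setIdx_idx], fr0⟩ ?_).imp fun τ hτ _ => ⟨hτ.1, hτ.2.1⟩
  · rintro i τ ⟨-, hi, hf⟩
    have : τ.idx B = n := by
      rw [hf.idx B ⟨hrB, kB, hrB⟩, hB]
    simp only [Test.Holds, hi, this]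
  · rintro i hi τ ⟨hI, hr, hf⟩
    refine Runs.seq (h i hi τ hI hr hf) fun υ hυ hfP => ?_
    have e1 : υ.idx r = i := by rw [hfP.idx r kr, hr]
    have e2 : υ.idx o = 1 := by rw [hfP.idx o ko, hf.idx o ⟨hro, ko, hro⟩, ho]
    refine Runs.instr ?_ ?_
    · simp only [Instr.outSize, IdxOp.apply, e1, e2]
      exact (natSize_le_self _).trans (by omega)
    · simp only [Instr.apply, IdxOp.apply, e1, e2]
      refine ⟨hυ, by simp [setIdx_idx], hf.trans ⟨fun r' hr' => ?_, fun a ha => ?_⟩⟩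
      · have : r' ≠ r := hr'.1
        simp only [setIdx_idx, this, if_false]
        exact hfP.idx r' hr'.2.1
      · exact hfP.mem a ha.2.1

theorem keepsReg_forLt {o r B : ℕ} {P : Prog} {r' : ℕ} :
    (forLt o r B P).KeepsReg r' ↔ r' ≠ r ∧ P.KeepsReg r' := by
  simp only [forLt, Prog.KeepsReg, Instr.KeepsReg]
  tauto

theorem avoids_forLt {o r B : ℕ} {P : Prog} {a : ℕ} :
    (forLt o r B P).Avoids a ↔ P.Avoids a := by
  simp only [forLt, Prog.Avoids, Instr.Avoids]
  tauto

/-- The program without any effect; formally, it may write to the register `r`. -/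
def skip (r : ℕ) : Prog := .loop (.idxLt r r) (.instr (.idxConst r 0))

theorem Runs.skip {r : ℕ} {σ : State} {Post : State → Prop} (h : Post σ) :
    Runs b N (skip r) σ Post :=
  ⟨1, σ, .loopDone (by simp [Test.Holds]), by simp [StrongPoly.skip, Prog.cost], h⟩

/-- `f 0; f 1; …; f (m - 1)`. -/
def rep (r : ℕ) (f : ℕ → Prog) : ℕ → Prog
  | 0 => skip r
  | m + 1 => .seq (rep r f m) (f m)

theorem keepsReg_rep {r : ℕ} {f : ℕ → Prog} {m r' : ℕ} :
    (rep r f m).KeepsReg r' ↔ r' ≠ r ∧ ∀ i < m, (f i).KeepsReg r' := by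
  induction m with
  | zero => simp [rep, skip, Prog.KeepsReg, Instr.KeepsReg]
  | succ m ih =>
    simp only [rep, Prog.KeepsReg, ih, Nat.lt_succ_iff_lt_or_eq, or_imp, forall_and, forall_eq,
      and_assoc]

theorem avoids_rep {r : ℕ} {f : ℕ → Prog} {m a : ℕ} :
    (rep r f m).Avoids a ↔ ∀ i < m, (f i).Avoids a := by
  induction m with
  | zero => simp [rep, skip, Prog.Avoids, Instr.Avoids]
  | succ m ih =>
    simp only [rep, Prog.Avoids, ih, Nat.lt_succ_iff_lt_or_eq, or_imp, forall_and, forall_eq]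

theorem Runs.rep {r : ℕ} {f : ℕ → Prog} {m : ℕ} {σ : State} (Inv : ℕ → State → Prop)
    (h₀ : Inv 0 σ) (h : ∀ i < m, ∀ σ', Inv i σ' → Frame (rep r f m) σ σ' →
      Runs b N (f i) σ' (Inv (i + 1))) : Runs b N (rep r f m) σ (Inv m) := by
  have key : ∀ l ≤ m, Runs b N (StrongPoly.rep r f l) σ (Inv l) := by
    intro l hl
    induction l with
    | zero => exact Runs.skip h₀
    | succ l ih =>
      refine Runs.seq (ih (by omega)) fun τ hτ hf => h l hl τ hτ ⟨fun r' hr' => ?_, fun a ha => ?_⟩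
      · rw [keepsReg_rep] at hr'
        exact hf.idx r' (keepsReg_rep.2 ⟨hr'.1, fun i hi => hr'.2 i (by omega)⟩)
      · rw [avoids_rep] at ha
        exact hf.mem a (avoids_rep.2 fun i hi => ha i (by omega))
  exact key m le_rfl

/-- Nested loops with the given pairs of counters and bounds. -/
def nest (o : ℕ) : List (ℕ × ℕ) → Prog → Prog
  | [], P => P
  | x :: L, P => forLt o x.1 x.2 (nest o L P)

theorem keepsReg_nest {o : ℕ} {L : List (ℕ × ℕ)} {P : Prog} {r : ℕ} :
    (nest o L P).KeepsReg r ↔ (∀ x ∈ L, r ≠ x.1) ∧ P.KeepsReg r := by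
  induction L with
  | nil => simp [nest]
  | cons x L ih => simp [nest, keepsReg_forLt, ih, and_assoc]

/-- Exhaustive search: if the body preserves `I`, establishes `G` for the current values of the
counters, and does not destroy what has been established, then the nested loops establish `G` for
all values of the counters within their bounds. -/
theorem Runs.nest {o : ℕ} {L : List (ℕ × ℕ)} {P : Prog} {σ : State} {I : State → Prop}
    {G : (ℕ → ℕ) → State → Prop} {D : ℕ → Prop} {β : ℕ → ℕ}
    (hN : ∀ x ∈ L, β x.2 ≤ N) (hb : ∀ x ∈ L, β x.2 ≤ b)
    (hnd : (L.map Prod.fst).Nodup) (hne : ∀ x ∈ L, ∀ y ∈ L, y.2 ≠ x.1) (hno : ∀ x ∈ L, o ≠ x.1)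
    (hP : ∀ x ∈ L, P.KeepsReg x.1 ∧ P.KeepsReg x.2) (hPo : P.KeepsReg o)
    (hD : ∀ r, D r → P.KeepsReg r)
    (hI : ∀ σ, ∀ x ∈ L, ∀ v, I σ → I (σ.setIdx x.1 v))
    (hG : ∀ c σ, ∀ x ∈ L, ∀ v, G c σ → G c (σ.setIdx x.1 v))
    (hβ : ∀ σ, I σ → σ.idx o = 1 ∧ ∀ x ∈ L, σ.idx x.2 = β x.2)
    (hGD : ∀ c c' σ, (∀ r, D r → c r = c' r) → G c σ → G c' σ)
    (body : ∀ σ, I σ → (∀ x ∈ L, σ.idx x.1 < β x.2) →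
      Runs b N P σ fun τ => I τ ∧ G σ.idx τ ∧ ∀ c, G c σ → G c τ)
    (hσ : I σ) :
    Runs b N (nest o L P) σ fun τ => I τ ∧ (∀ c, G c σ → G c τ) ∧
      ∀ c, (∀ r, D r → (∀ x ∈ L, r ≠ x.1) → c r = σ.idx r) →
        (∀ x ∈ L, c x.1 < β x.2) → G c τ := by
  induction L generalizing σ I with
  | nil =>
    refine (body σ hσ (by simp)).imp fun τ hτ _ => ⟨hτ.1, hτ.2.2, fun c hc _ => ?_⟩
    exact hGD σ.idx c τ (fun r hr => (hc r hr (by simp)).symm) hτ.2.1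
  | cons x L ih =>
    simp only [List.mem_cons, forall_eq_or_imp, List.map_cons, List.nodup_cons, List.mem_map,
      not_exists, not_and] at *
    have hx : ∀ y ∈ L, y.1 ≠ x.1 := fun y hy => hnd.1 y hy
    refine (Runs.forLt (n := β x.2)
      (fun i τ => I τ ∧ (∀ c, G c σ → G c τ) ∧
        ∀ c, (∀ r, D r → (r ≠ x.1 ∧ ∀ y ∈ L, r ≠ y.1) → c r = σ.idx r) →
          (c x.1 < i ∧ ∀ y ∈ L, c y.1 < β y.2) → G c τ)
      hN.1 hb.1 (hβ σ hσ).1 (hβ σ hσ).2.1 hno.1 hne.1.1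
      (keepsReg_nest.2 ⟨fun y hy => (hx y hy).symm, hP.1.1⟩)
      (keepsReg_nest.2 ⟨hno.2, hPo⟩)
      (keepsReg_nest.2 ⟨fun y hy => (hne.2 y hy).1, hP.1.2⟩) ?_ ?_).imp fun τ hτ _ => hτ.1
    · exact ⟨(hI σ).1 0 hσ, fun c hc => (hG c σ).1 0 hc, fun c _ h => absurd h.1 (by omega)⟩
    · intro i hi σ' ⟨h1, h2, h3⟩ hr hf
      -- For the inner loops the value of the current counter becomes part of the invariant, so that
      -- the body knows this counter to be within its bound.
      refine (ih (I := fun τ => I τ ∧ τ.idx x.1 = i) hN.2 hb.2 hnd.2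
        (fun y hy z hz => (hne.2 y hy).2 z hz) hno.2 hP.2
        (fun σ y hy v h => ⟨(hI σ).2 y hy v h.1, by
          rw [setIdx_idx, if_neg (hx y hy).symm, h.2]⟩)
        (fun c σ y hy => (hG c σ).2 y hy)
        (fun σ h => ⟨(hβ σ h.1).1, (hβ σ h.1).2.2⟩)
        (fun σ h hl => ?_) ⟨h1, hr⟩).imp ?_
      · refine (body σ h.1 ⟨by rw [h.2]; exact hi, hl⟩).imp fun τ hτ hfr => ⟨⟨hτ.1, ?_⟩, hτ.2⟩
        rw [hfr.idx _ hP.1.1, h.2]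
      · rintro τ ⟨⟨g1, -⟩, g2, g3⟩ -
        refine ⟨(hI τ).1 _ g1, fun c hc => (hG c τ).1 _ (g2 c (h2 c hc)), fun c hc hl => ?_⟩
        apply (hG c τ).1
        -- Smaller values of this counter were settled in earlier rounds and survive; the value `i`
        -- is settled by the round just completed.
        rcases Nat.lt_succ_iff_lt_or_eq.1 hl.1 with hlt | heq
        · exact g2 c (h3 c hc ⟨hlt, hl.2⟩)
        · refine g3 c (fun r hr' hrL => ?_) hl.2
          by_cases hrx : r = x.1
          · rw [hrx, heq, hr]
          · rw [hc r hr' ⟨hrx, hrL⟩]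
            exact (hf.idx r (keepsReg_forLt.2 ⟨hrx, keepsReg_nest.2 ⟨hrL, hD r hr'⟩⟩)).symm

/-! ### Encoding lengths -/

/-- Numerator and denominator are at most `2 ^ m`. -/
def Fits (m : ℕ) (x : ℚ) : Prop := x.num.natAbs ≤ 2 ^ m ∧ x.den ≤ 2 ^ m

theorem Fits.mono {m m' : ℕ} {x : ℚ} (h : Fits m x) (hm : m ≤ m') : Fits m' x :=
  ⟨h.1.trans (Nat.pow_le_pow_right (by norm_num) hm),
    h.2.trans (Nat.pow_le_pow_right (by norm_num) hm)⟩

theorem fits_ratSize (x : ℚ) : Fits (ratSize x) x := by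
  constructor
  · refine (Nat.lt_size_self _).le.trans (Nat.pow_le_pow_right (by norm_num) ?_)
    simp only [ratSize]; omega
  · refine (Nat.lt_size_self _).le.trans (Nat.pow_le_pow_right (by norm_num) ?_)
    simp only [ratSize]; omega

theorem Fits.ratSize_le {m : ℕ} {x : ℚ} (h : Fits m x) : ratSize x ≤ 2 * m + 3 := by
  have h1 : Nat.size x.num.natAbs ≤ m + 1 :=
    Nat.size_le.2 (h.1.trans_lt (Nat.pow_lt_pow_right (by norm_num) (by omega)))
  have h2 : Nat.size x.den ≤ m + 1 :=
    Nat.size_le.2 (h.2.trans_lt (Nat.pow_lt_pow_right (by norm_num) (by omega)))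
  simp only [ratSize]; omega

theorem natAbs_num_eq (x : ℚ) : (x.num.natAbs : ℚ) = |x| * x.den := by
  rw [Nat.cast_natAbs, Int.cast_abs, ← abs_of_nonneg (Nat.cast_nonneg (α := ℚ) x.den), ← abs_mul,
    Rat.mul_den_eq_num]

theorem Fits.abs_le {m : ℕ} {x : ℚ} (h : Fits m x) : |x| ≤ 2 ^ m := by
  have h1 : (1 : ℚ) ≤ x.den := by exact_mod_cast x.pos
  have h2 : (x.num.natAbs : ℚ) ≤ 2 ^ m := by exact_mod_cast h.1
  rw [natAbs_num_eq] at h2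
  nlinarith [abs_nonneg x]

/-- The numerator is the absolute value times the denominator. Absolute values and denominators are
easier to control under arithmetic than reduced numerators. -/
theorem fits_of_abs_le {A D : ℕ} {x : ℚ} (hA : |x| ≤ 2 ^ A) (hD : x.den ≤ 2 ^ D) :
    Fits (A + D) x := by
  refine ⟨?_, hD.trans (Nat.pow_le_pow_right (by norm_num) (by omega))⟩
  have h2 : (x.den : ℚ) ≤ 2 ^ D := by exact_mod_cast hD
  have : (x.num.natAbs : ℚ) ≤ 2 ^ (A + D) := by
    rw [natAbs_num_eq, pow_add]
    gcongr
  exact_mod_cast this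

theorem fits_zero (m : ℕ) : Fits m 0 := by simp [Fits, Nat.one_le_two_pow]

theorem fits_one (m : ℕ) : Fits m 1 := by simp [Fits, Nat.one_le_two_pow]

/-- The estimate gives `3 * m + 1`; it is weakened so that a single recursion `m ↦ 4 * m + 1` covers
all four operations. -/
theorem Fits.add {m : ℕ} {x y : ℚ} (hx : Fits m x) (hy : Fits m y) : Fits (4 * m + 1) (x + y) := by
  have h1 : |x + y| ≤ 2 ^ (m + 1) := by
    rw [pow_succ]
    linarith [abs_add_le x y, hx.abs_le, hy.abs_le]
  have h2 : (x + y).den ≤ 2 ^ (m + m) := by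
    rw [pow_add]
    exact (Nat.le_of_dvd (Nat.mul_pos x.pos y.pos) (Rat.add_den_dvd x y)).trans
      (Nat.mul_le_mul hx.2 hy.2)
  exact (fits_of_abs_le h1 h2).mono (by omega)

theorem Fits.mul {m : ℕ} {x y : ℚ} (hx : Fits m x) (hy : Fits m y) : Fits (4 * m + 1) (x * y) := by
  have h1 : |x * y| ≤ 2 ^ (m + m) := by
    rw [pow_add, abs_mul]
    exact mul_le_mul hx.abs_le hy.abs_le (abs_nonneg _) (by positivity)
  have h2 : (x * y).den ≤ 2 ^ (m + m) := by
    rw [pow_add]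
    exact (Nat.le_of_dvd (Nat.mul_pos x.pos y.pos) (Rat.mul_den_dvd x y)).trans
      (Nat.mul_le_mul hx.2 hy.2)
  exact (fits_of_abs_le h1 h2).mono (by omega)

theorem Fits.neg {m : ℕ} {x : ℚ} (hx : Fits m x) : Fits m (-x) := by
  simpa [Fits] using hx

theorem Fits.inv {m : ℕ} {x : ℚ} (hx : Fits m x) : Fits m x⁻¹ := by
  by_cases h : x = 0
  · simpa [h] using fits_zero m
  · have h0 : x.num ≠ 0 := by simpa using h
    constructor
    · rw [Rat.num_inv, Int.natAbs_mul, Int.natAbs_sign_of_ne_zero h0]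
      simpa using hx.2
    · rw [Rat.den_inv, if_neg h0]
      exact hx.1

theorem Fits.op {m : ℕ} {x y : ℚ} (op : RatOp) (hx : Fits m x) (hy : Fits m y) :
    Fits (4 * m + 1) (op.apply x y) := by
  cases op
  · exact hx.add hy
  · simpa only [RatOp.apply, sub_eq_add_neg] using hx.add hy.neg
  · exact hx.mul hy
  · simpa only [RatOp.apply, div_eq_mul_inv] using hx.mul hy.inv

/-- Iterating `Fits.add` would give a bound exponential in `l`. Instead the absolute value is
bounded by `l * 2 ^ m` and the denominator by the product of all denominators. -/
theorem fits_sum {m l : ℕ} {f : ℕ → ℚ} (h : ∀ k < l, Fits m (f k)) :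
    Fits (l + m + l * m) (∑ k ∈ Finset.range l, f k) := by
  have h1 : |∑ k ∈ Finset.range l, f k| ≤ 2 ^ (l + m) := by
    have hs : ∑ k ∈ Finset.range l, |f k| ≤ ∑ k ∈ Finset.range l, (2 : ℚ) ^ m :=
      Finset.sum_le_sum fun k hk => (h k (Finset.mem_range.1 hk)).abs_le
    have hl : (l : ℚ) ≤ 2 ^ l := by exact_mod_cast Nat.lt_two_pow_self.le
    rw [Finset.sum_const, Finset.card_range, nsmul_eq_mul] at hs
    rw [pow_add]
    exact (Finset.abs_sum_le_sum_abs _ _).trans (hs.trans (by gcongr))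
  have h2 : (∑ k ∈ Finset.range l, f k).den ≤ 2 ^ (l * m) := by
    clear h1
    induction l with
    | zero => simp
    | succ l ih =>
      rw [Finset.sum_range_succ, Nat.succ_mul, pow_add]
      exact (Nat.le_of_dvd (Nat.mul_pos (Rat.pos _) (Rat.pos _)) (Rat.add_den_dvd _ _)).trans
        (Nat.mul_le_mul (ih fun k hk => h k (by omega)) (h l (by omega)).2)
  exact fits_of_abs_le h1 h2

end StrongPoly

namespace BoolSearch

open Finset

/-! ### Sign patterns by elimination -/

/-- `0` or `1` according to the sign of `-r`, and `x` if `r = 0`. -/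
def override (r x : ℚ) : ℚ := if 0 < r then 0 else if r < 0 then 1 else x

/-- The vectors `(v p k)ₚ` after elimination of the first `i` coordinates, where the `i`-th coordinate
is eliminated by means of the vector number `κ i`. -/
def elim (v : ℕ → ℕ → ℚ) (κ : ℕ → ℕ) : ℕ → ℕ → ℕ → ℚ
  | 0 => v
  | i + 1 => fun p k =>
    elim v κ i p k - elim v κ i i k / elim v κ i i (κ i) * elim v κ i p (κ i)

/-- The three signs. -/
def sgn : ℕ → ℚ
  | 1 => 1
  | 2 => -1
  | _ => 0

/-- The sign pattern determined by pivots `κ` and signs `σ`. -/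
def pattern (v : ℕ → ℕ → ℚ) (κ σ : ℕ → ℕ) : ℕ → ℕ → ℚ
  | 0 => fun _ => 0
  | i + 1 => fun k => override (elim v κ i i k * sgn (σ i)) (pattern v κ σ i k)

theorem override_binary {r x : ℚ} (hx : x = 0 ∨ x = 1) :
    override r x = 0 ∨ override r x = 1 := by
  unfold override; split_ifs <;> simp [hx]

theorem pattern_binary (v : ℕ → ℕ → ℚ) (κ σ : ℕ → ℕ) (i k : ℕ) :
    pattern v κ σ i k = 0 ∨ pattern v κ σ i k = 1 := by
  induction i with
  | zero => simp [pattern]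
  | succ i ih => exact override_binary ih

theorem elim_congr {v : ℕ → ℕ → ℚ} {κ κ' : ℕ → ℕ} {i : ℕ} (h : ∀ j < i, κ j = κ' j) :
    elim v κ i = elim v κ' i := by
  induction i with
  | zero => rfl
  | succ i ih =>
    simp only [elim, ih fun j hj => h j (by omega), h i (by omega)]

theorem pattern_congr {v : ℕ → ℕ → ℚ} {κ κ' σ σ' : ℕ → ℕ} {i : ℕ} (h : ∀ j < i, κ j = κ' j)
    (h' : ∀ j < i, σ j = σ' j) : pattern v κ σ i = pattern v κ' σ' i := by
  induction i with
  | zero => rfl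
  | succ i ih =>
    simp only [pattern, ih (fun j hj => h j (by omega)) fun j hj => h' j (by omega),
      h' i (by omega), elim_congr fun j (hj : j < i) => h j (by omega)]

theorem exists_sgn (θ : ℚ) : ∃ c < 3, (0 < θ → sgn c = 1) ∧ (θ < 0 → sgn c = -1) ∧
    (θ = 0 → sgn c = 0) := by
  rcases lt_trichotomy θ 0 with h | h | h
  · exact ⟨2, by norm_num, fun h' => absurd h' h.not_gt, fun _ => rfl, fun h' => absurd h' h.ne⟩
  · exact ⟨0, by norm_num, fun h' => absurd h h'.ne', fun h' => absurd h h'.ne, fun _ => rfl⟩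
  · exact ⟨1, by norm_num, fun _ => rfl, fun h' => absurd h' h.not_gt, fun h' => absurd h' h.ne'⟩

/-- Subtracting from `L` a number of no larger absolute value cannot reverse its sign. Where the
difference is zero, `L = u * θ` has the sign of `u * c`, as `c` is the sign of `θ`. -/
theorem override_override {L u θ c x : ℚ} (hθ : |u * θ| ≤ |L|) (h₁ : 0 < θ → c = 1)
    (h₂ : θ < 0 → c = -1) (h₃ : θ = 0 → c = 0) :
    override (L - u * θ) (override (u * c) x) = override L x := by
  rcases lt_trichotomy (L - u * θ) 0 with h | h | h
  · have hL : L < 0 := by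
      by_contra h'
      rw [abs_of_nonneg (not_lt.1 h')] at hθ
      linarith [le_abs_self (u * θ)]
    simp [override, h, hL, h.not_gt, hL.not_gt]
  · have hL : L = u * θ := by linarith
    have h0 : override (L - u * θ) (override (u * c) x) = override (u * c) x := by
      simp [override, h]
    rw [h0, hL]
    rcases lt_trichotomy θ 0 with h | h | h
    · rw [h₂ h]
      have e1 : 0 < u * θ ↔ u < 0 := by
        constructor
        · intro h'; by_contra hu; nlinarith
        · intro h'; nlinarith
      have e2 : u * θ < 0 ↔ 0 < u := by
        constructor
        · intro h'; by_contra hu; nlinarith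
        · intro h'; nlinarith
      simp [override, e1, e2]
    · rw [h₃ h, h]
    · rw [h₁ h]
      have e : u * θ < 0 ↔ u < 0 := by
        constructor
        · intro h'; by_contra hu; nlinarith
        · intro h'; nlinarith
      simp [override, mul_pos_iff_of_pos_right h, e]
  · have hL : 0 < L := by
      by_contra h'
      rw [abs_of_nonpos (not_lt.1 h')] at hθ
      linarith [neg_abs_le (u * θ)]
    simp [override, h, hL]

/-- The pivot minimizes `|L k / u k|` over the entries with `u k ≠ 0`. If `u` vanishes identically,
any index in range serves, because division by zero gives zero. -/
theorem exists_pivot (n : ℕ) (hn : 0 < n) (u L : ℕ → ℚ) :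
    ∃ κ < n, (u κ = 0 → ∀ k < n, u k = 0) ∧ ∀ k < n, |u k * (L κ / u κ)| ≤ |L k| := by
  by_cases h : ∃ k < n, u k ≠ 0
  · obtain ⟨k₁, hk₁, hu₁⟩ := h
    obtain ⟨κ, hκ, hmin⟩ := ((range n).filter fun k => u k ≠ 0).exists_min_image
      (fun k => |L k / u k|) ⟨k₁, by simp [hk₁, hu₁]⟩
    simp only [mem_filter, mem_range] at hκ hmin
    refine ⟨κ, hκ.1, fun h => absurd h hκ.2, fun k hk => ?_⟩
    by_cases hu : u k = 0
    · simp [hu]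
    · calc |u k * (L κ / u κ)| = |u k| * |L κ / u κ| := abs_mul _ _
        _ ≤ |u k| * |L k / u k| := mul_le_mul_of_nonneg_left (hmin k ⟨hk, hu⟩) (abs_nonneg _)
        _ = |L k| := by rw [← abs_mul]; congr 1; field_simp
  · push Not at h
    refine ⟨0, hn, fun _ => h, fun k hk => by simp [h k hk]⟩

/-- Induction on the number `m` of coordinates still to be eliminated. The pattern built so far
matters only where the remaining form vanishes, which is why later stages override earlier ones; at
`m = 0` the form is empty and nothing is overridden. -/
theorem exists_pattern_from {n : ℕ} (hn : 0 < n) (d : ℕ) (v : ℕ → ℕ → ℚ) (w : ℕ → ℚ) (m : ℕ) :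
    ∀ (i : ℕ) (κ σ : ℕ → ℕ), i + m = d → ∃ κ' σ' : ℕ → ℕ,
      (∀ j < i, κ' j = κ j ∧ σ' j = σ j) ∧ (∀ j, i ≤ j → j < d → κ' j < n ∧ σ' j < 3) ∧
      ∀ k < n, pattern v κ' σ' d k =
        override (∑ p ∈ Ico i d, w p * elim v κ i p k) (pattern v κ σ i k) := by
  induction m with
  | zero =>
    intro i κ σ hi
    obtain rfl : i = d := by omega
    exact ⟨κ, σ, fun _ _ => ⟨rfl, rfl⟩, fun _ _ _ => by omega, fun k _ => by simp [override]⟩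
  | succ m ih =>
    intro i κ σ hi
    set u : ℕ → ℚ := fun k => elim v κ i i k with hu
    set L : ℕ → ℚ := fun k => ∑ p ∈ Ico i d, w p * elim v κ i p k with hL
    obtain ⟨k₀, hk₀, hu₀, hmin⟩ := exists_pivot n hn u L
    obtain ⟨c, hc, hc₁, hc₂, hc₃⟩ := exists_sgn (L k₀ / u k₀)
    obtain ⟨κ', σ', h1, h2, h3⟩ :=
      ih (i + 1) (Function.update κ i k₀) (Function.update σ i c) (by omega)
    have hκ : ∀ j < i, Function.update κ i k₀ j = κ j := fun j hj => by
      simp [hj.ne]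
    have hσ : ∀ j < i, Function.update σ i c j = σ j := fun j hj => by
      simp [hj.ne]
    refine ⟨κ', σ', fun j hj => ?_, fun j hj hjd => ?_, fun k hk => ?_⟩
    · rw [(h1 j (by omega)).1, (h1 j (by omega)).2, hκ j hj, hσ j hj]; exact ⟨rfl, rfl⟩
    · rcases hj.eq_or_lt with rfl | hlt
      · rw [(h1 i (by omega)).1, (h1 i (by omega)).2]
        simpa using ⟨hk₀, hc⟩
      · exact h2 j hlt hjd
    · rw [h3 k hk]
      have e1 : pattern v (Function.update κ i k₀) (Function.update σ i c) (i + 1) k =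
          override (u k * sgn c) (pattern v κ σ i k) := by
        simp only [pattern, elim_congr hκ, pattern_congr hκ hσ, Function.update_self, hu]
      have e2 : ∑ p ∈ Ico (i + 1) d, w p * elim v (Function.update κ i k₀) (i + 1) p k =
          L k - u k * (L k₀ / u k₀) := by
        have hterm : ∀ p, elim v (Function.update κ i k₀) (i + 1) p k =
            elim v κ i p k - u k / u k₀ * elim v κ i p k₀ := fun p => by
          simp only [elim, elim_congr hκ, Function.update_self, hu]
        have hall : ∑ p ∈ Ico i d, w p * (elim v κ i p k - u k / u k₀ * elim v κ i p k₀) =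
            L k - u k * (L k₀ / u k₀) := by
          simp only [hL, mul_sub, sum_sub_distrib]
          congr 1
          rw [mul_div_assoc', mul_comm (u k), mul_div_assoc, sum_mul]
          exact sum_congr rfl fun p _ => by ring
        rw [← hall, sum_eq_sum_Ico_succ_bot (by omega : i < d)]
        simp only [hterm]
        -- The coefficient `w i` drops out here. This holds also if the pivot entry is zero, since
        -- then `u` vanishes on the whole range.
        have : w i * (elim v κ i i k - u k / u k₀ * elim v κ i i k₀) = 0 := by
          change w i * (u k - u k / u k₀ * u k₀) = 0
          by_cases h0 : u k₀ = 0
          · simp [hu₀ h0 k hk]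
          · rw [div_mul_cancel₀ _ h0]; simp
        rw [this, zero_add]
      rw [e1, e2]
      exact override_override (hmin k hk) hc₁ hc₂ hc₃

/-- Every sign pattern of a linear form on the vectors `(v p k)ₚ` comes from pivots and signs. -/
theorem exists_pattern {n : ℕ} (hn : 0 < n) (d : ℕ) (v : ℕ → ℕ → ℚ) (w : ℕ → ℚ) :
    ∃ κ σ : ℕ → ℕ, (∀ i < d, κ i < n ∧ σ i < 3) ∧
      ∀ k < n, pattern v κ σ d k = override (∑ p ∈ range d, w p * v p k) 0 := by
  obtain ⟨κ, σ, -, h2, h3⟩ := exists_pattern_from hn d v w d 0 0 0 (by omega)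
  exact ⟨κ, σ, fun i hi => h2 i (Nat.zero_le _) hi, fun k hk => by
    rw [h3 k hk, range_eq_Ico]; rfl⟩

/-! ### Candidates and the objective function -/

/-- The sign pattern with the entry number `t` replaced by `1`. -/
def candidate (v : ℕ → ℕ → ℚ) (d : ℕ) (κ σ : ℕ → ℕ) (t : ℕ) (k : ℕ) : ℚ :=
  if k = t then 1 else pattern v κ σ d k

theorem candidate_binary (v : ℕ → ℕ → ℚ) (d : ℕ) (κ σ : ℕ → ℕ) (t k : ℕ) :
    candidate v d κ σ t k = 0 ∨ candidate v d κ σ t k = 1 := by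
  unfold candidate; split_ifs
  · simp
  · exact pattern_binary _ _ _ _ _

/-- The first `n` entries of `x` are binary and not all zero. -/
def Admissible (n : ℕ) (x : ℕ → ℚ) : Prop := (∀ k < n, x k = 0 ∨ x k = 1) ∧ ∃ k < n, x k = 1

theorem candidate_admissible {n : ℕ} (v : ℕ → ℕ → ℚ) (d : ℕ) (κ σ : ℕ → ℕ) {t : ℕ} (ht : t < n) :
    Admissible n (candidate v d κ σ t) :=
  ⟨fun k _ => candidate_binary v d κ σ t k, t, ht, by simp [candidate]⟩

/-- If some coefficient is negative, the sign pattern is optimal, and `t` is an entry where it is 1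
already. Otherwise the pattern is zero on the range, and the optimum among nonzero vectors is a unit
vector at a smallest coefficient. -/
theorem exists_candidate_le {n : ℕ} (d : ℕ) (v : ℕ → ℕ → ℚ) (w : ℕ → ℚ) {y : ℕ → ℚ}
    (hy : Admissible n y) : ∃ (κ σ : ℕ → ℕ) (t : ℕ), (∀ i < d, κ i < n ∧ σ i < 3) ∧ t < n ∧
      ∑ k ∈ range n, (∑ p ∈ range d, w p * v p k) * candidate v d κ σ t k ≤
        ∑ k ∈ range n, (∑ p ∈ range d, w p * v p k) * y k := by
  obtain ⟨hy, k₁, hk₁, hy₁⟩ := hy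
  have hn : 0 < n := by omega
  obtain ⟨κ, σ, hκσ, hpat⟩ := exists_pattern hn d v w
  set L : ℕ → ℚ := fun k => ∑ p ∈ range d, w p * v p k with hL
  by_cases hneg : ∃ k < n, L k < 0
  · obtain ⟨t, ht, hLt⟩ := hneg
    refine ⟨κ, σ, t, hκσ, ht, sum_le_sum fun k hk => ?_⟩
    have hk := mem_range.1 hk
    have e : candidate v d κ σ t k = override (L k) 0 := by
      unfold candidate
      split_ifs with h
      · simp [override, h, hLt, hLt.not_gt]
      · exact hpat k hk
    change L k * _ ≤ L k * _
    rw [e]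
    unfold override
    split_ifs with h1 h2
    · rcases hy k hk with h | h <;> simp only [h] <;> linarith
    · rcases hy k hk with h | h <;> simp only [h] <;> linarith
    · have : L k = 0 := by linarith
      simp [this]
  · push Not at hneg
    obtain ⟨t, ht, hmin⟩ := (range n).exists_min_image L ⟨k₁, mem_range.2 hk₁⟩
    refine ⟨κ, σ, t, hκσ, mem_range.1 ht, ?_⟩
    have e : ∀ k ∈ range n, (∑ p ∈ range d, w p * v p k) * candidate v d κ σ t k =
        if k = t then L t else 0 := by
      intro k hk
      unfold candidate
      split_ifs with h
      · rw [h, mul_one]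
      · have h0 := hneg k (mem_range.1 hk)
        change L k * _ = 0
        rw [hpat k (mem_range.1 hk)]
        change L k * override (L k) 0 = 0
        unfold override
        split_ifs with h1 <;> simp
        linarith
    rw [sum_congr rfl e, sum_ite_eq' (range n) t, if_pos ht]
    calc L t ≤ L k₁ * y k₁ := by rw [hy₁, mul_one]; exact hmin k₁ (mem_range.2 hk₁)
      _ ≤ ∑ k ∈ range n, L k * y k := by
        refine single_le_sum (f := fun k => L k * y k) (fun k hk => ?_) (mem_range.2 hk₁)
        have := hneg k (mem_range.1 hk)
        rcases hy k (mem_range.1 hk) with h | h <;> simp [h, this]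

/-- A sum of `d` products of linear forms, where the `j`-th factors are forms in the vector `x j`. -/
def objective (s d : ℕ) (n : ℕ → ℕ) (γ : ℕ → ℚ) (v : ℕ → ℕ → ℕ → ℚ) (x : ℕ → ℕ → ℚ) : ℚ :=
  ∑ p ∈ range d, γ p * ∏ j ∈ range s, ∑ k ∈ range (n j), v j p k * x j k

variable {s d : ℕ} {n : ℕ → ℕ} {γ : ℕ → ℚ} {v : ℕ → ℕ → ℕ → ℚ}

theorem objective_congr {x y : ℕ → ℕ → ℚ} (h : ∀ j < s, ∀ k < n j, x j k = y j k) :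
    objective s d n γ v x = objective s d n γ v y := by
  unfold objective
  refine sum_congr rfl fun p _ => ?_
  congr 1
  refine prod_congr rfl fun j hj => sum_congr rfl fun k hk => ?_
  rw [h j (mem_range.1 hj) k (mem_range.1 hk)]

/-- The products over the other factors do not involve the `j`-th vector; they become the weights of
a linear form, as `exists_candidate_le` requires. -/
theorem objective_update (x : ℕ → ℕ → ℚ) {j : ℕ} (hj : j < s) (z : ℕ → ℚ) :
    objective s d n γ v (Function.update x j z) =
      ∑ k ∈ range (n j), (∑ p ∈ range d, (γ p * ∏ i ∈ (range s).erase j,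
        ∑ k ∈ range (n i), v i p k * x i k) * v j p k) * z k := by
  simp only [objective, sum_mul]
  rw [sum_comm]
  refine sum_congr rfl fun p _ => ?_
  rw [← mul_prod_erase _ _ (mem_range.2 hj), Function.update_self]
  have : ∏ i ∈ (range s).erase j, ∑ k ∈ range (n i), v i p k * Function.update x j z i k =
      ∏ i ∈ (range s).erase j, ∑ k ∈ range (n i), v i p k * x i k :=
    prod_congr rfl fun i hi => by rw [Function.update_of_ne (ne_of_mem_erase hi)]
  rw [this, sum_mul, mul_sum]
  exact sum_congr rfl fun k _ => by ring

/-- Among the best admissible vectors there are candidates. -/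
theorem exists_candidates_le {x : ℕ → ℕ → ℚ} (hx : ∀ j < s, Admissible (n j) (x j)) :
    ∃ (κ σ : ℕ → ℕ → ℕ) (t : ℕ → ℕ),
      (∀ j < s, (∀ i < d, κ j i < n j ∧ σ j i < 3) ∧ t j < n j) ∧
      objective s d n γ v (fun j => candidate (v j) d (κ j) (σ j) (t j)) ≤
        objective s d n γ v x := by
  -- The vectors are replaced one at a time. The weights depend on the vectors present at that
  -- moment, but the range of pivots, signs and special entries does not.
  have key : ∀ m ≤ s, ∃ (κ σ : ℕ → ℕ → ℕ) (t : ℕ → ℕ),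
      (∀ j < m, (∀ i < d, κ j i < n j ∧ σ j i < 3) ∧ t j < n j) ∧
      objective s d n γ v
        (fun j => if j < m then candidate (v j) d (κ j) (σ j) (t j) else x j) ≤
        objective s d n γ v x := by
    intro m hm
    induction m with
    | zero => exact ⟨0, 0, 0, by simp, by simp⟩
    | succ m ih =>
      obtain ⟨κ, σ, t, hv, hle⟩ := ih (by omega)
      set X : ℕ → ℕ → ℚ := fun j => if j < m then candidate (v j) d (κ j) (σ j) (t j) else x j
        with hX
      obtain ⟨κ₁, σ₁, t₁, h1, h2, h3⟩ := exists_candidate_le d (v m)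
        (fun p => γ p * ∏ i ∈ (range s).erase m, ∑ k ∈ range (n i), v i p k * X i k)
        (hx m (by omega))
      rw [← objective_update X (by omega : m < s), ← objective_update X (by omega : m < s)] at h3
      refine ⟨Function.update κ m κ₁, Function.update σ m σ₁, Function.update t m t₁,
        fun j hj => ?_, ?_⟩
      · rcases Nat.lt_succ_iff_lt_or_eq.1 hj with h | rfl
        · simpa [Function.update_of_ne h.ne] using hv j h
        · simpa using ⟨h1, h2⟩
      · refine le_of_eq_of_le (objective_congr fun j _ k _ => ?_)
          (h3.trans (le_of_eq_of_le (objective_congr fun j _ k _ => ?_) hle))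
        · rcases lt_trichotomy j m with h | rfl | h
          · simp [hX, h, h.ne, h.trans (Nat.lt_succ_self m)]
          · simp
          · simp [hX, h.ne', h.not_gt, show ¬ j < m + 1 by omega]
        · by_cases h : j = m
          · subst h; simp [hX]
          · simp [Function.update_of_ne h]
  obtain ⟨κ, σ, t, hv, hle⟩ := key s le_rfl
  refine ⟨κ, σ, t, hv, le_of_eq_of_le (objective_congr fun j hj k _ => ?_) hle⟩
  simp [hj]

end BoolSearch

namespace BoolSearch

open Finset StrongPoly

/-! ### Names of registers and arrays -/

/-- The index registers that do not hold dimensions. -/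
def reg (s kind j i : ℕ) : ℕ := s + Nat.pair kind (Nat.pair j i)

/-- The arrays that hold neither input nor output. -/
def arr (s q kind j i p : ℕ) : ℕ := (q + 1) * s + Nat.pair kind (Nat.pair j (Nat.pair i p))

-- Injectivity of `Nat.pair` turns the many disjointness conditions on names into computations for
-- `simp`.
@[simp] theorem reg_inj {s k j i k' j' i' : ℕ} :
    reg s k j i = reg s k' j' i' ↔ k = k' ∧ j = j' ∧ i = i' := by
  simp [reg, Nat.pair_eq_pair]

@[simp] theorem arr_inj {s q k j i p k' j' i' p' : ℕ} :
    arr s q k j i p = arr s q k' j' i' p' ↔ k = k' ∧ j = j' ∧ i = i' ∧ p = p' := by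
  simp [arr, Nat.pair_eq_pair]

theorem ne_reg {s j k j' i : ℕ} (h : j < s) : j ≠ reg s k j' i := by
  simp only [reg]; omega

section Names

variable (s q : ℕ)

/-- `rK` is the scratch counter of all loops over an array; `rZ`, `rO` and `rT` serve as the
constants 0, 1 and 3. -/
abbrev rK : ℕ := reg s 0 0 0
abbrev rZ : ℕ := reg s 1 0 0
abbrev rO : ℕ := reg s 2 0 0
abbrev rT : ℕ := reg s 3 0 0
abbrev pivotReg (j i : ℕ) : ℕ := reg s 4 j i
abbrev signReg (j i : ℕ) : ℕ := reg s 5 j i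
abbrev starReg (j : ℕ) : ℕ := reg s 6 j 0

/-- The entries 0, 1, 2 are to hold the values of `sgn`. Entry 0 is also the constant zero, so an
array is copied by adding this entry. -/
abbrev aSgn : ℕ := arr s q 0 0 0 0
-- Intended for vector number `p` of the factor `j` after `i` eliminations. Every stage has its own
-- arrays, so the original vectors at `i = 0` remain available.
abbrev aW (j i p : ℕ) : ℕ := arr s q 1 j i p
abbrev aR : ℕ := arr s q 2 0 0 0
abbrev aQ : ℕ := arr s q 3 0 0 0
abbrev aS : ℕ := arr s q 4 0 0 0
abbrev aX (j : ℕ) : ℕ := arr s q 5 j 0 0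
abbrev aY : ℕ := arr s q 6 0 0 0
abbrev aP : ℕ := arr s q 7 0 0 0
abbrev aZ (p : ℕ) : ℕ := arr s q 8 p 0 0
abbrev aObj : ℕ := arr s q 9 0 0 0
abbrev aBest : ℕ := arr s q 10 0 0 0
abbrev aBestX (j : ℕ) : ℕ := arr s q 11 j 0 0

/-! ### Loops over an array -/

/-- Entrywise `a := b op c`, where entries `i` and `k` of `b` and `c` are taken. -/
def vec (B : ℕ) (op : RatOp) (a b i c k : ℕ) : Prog :=
  forLt (rO s) (rK s) B (.instr (.ratArith op a (rK s) b i c k))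

/-- Entrywise `x := override r x`. -/
def overrideLoop (B x r : ℕ) : Prog :=
  forLt (rO s) (rK s) B
    (.ite (.ratLt (aSgn s q) (rZ s) r (rK s)) (.instr (.ratConst x (rK s) 0))
      (.ite (.ratLt r (rK s) (aSgn s q) (rZ s)) (.instr (.ratConst x (rK s) 1))
        (.instr (.ratArith .add x (rK s) x (rK s) (aSgn s q) (rZ s)))))

/-- `y[0] := ∑ p`. -/
def sumLoop (B y p : ℕ) : Prog :=
  .seq (.instr (.ratConst y (rZ s) 0))
    (forLt (rO s) (rK s) B (.instr (.ratArith .add y (rZ s) y (rZ s) p (rK s))))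

end Names

variable {s q b N n : ℕ} {σ : State} {B : ℕ}

theorem keepsReg_vec {op : RatOp} {a e i c k r : ℕ} :
    (vec s B op a e i c k).KeepsReg r ↔ r ≠ rK s := by
  simp [vec, keepsReg_forLt, Prog.KeepsReg, Instr.KeepsReg]

theorem avoids_vec {op : RatOp} {a e i c k a' : ℕ} :
    (vec s B op a e i c k).Avoids a' ↔ a' ≠ a := by
  simp [vec, avoids_forLt, Prog.Avoids, Instr.Avoids]

theorem keepsReg_overrideLoop {x r r' : ℕ} :
    (overrideLoop s q B x r).KeepsReg r' ↔ r' ≠ rK s := by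
  simp [overrideLoop, keepsReg_forLt, Prog.KeepsReg, Instr.KeepsReg]

theorem avoids_overrideLoop {x r a : ℕ} :
    (overrideLoop s q B x r).Avoids a ↔ a ≠ x := by
  simp [overrideLoop, avoids_forLt, Prog.Avoids, Instr.Avoids]

theorem keepsReg_sumLoop {y p r : ℕ} : (sumLoop s B y p).KeepsReg r ↔ r ≠ rK s := by
  simp [sumLoop, keepsReg_forLt, Prog.KeepsReg, Instr.KeepsReg]

theorem avoids_sumLoop {y p a : ℕ} : (sumLoop s B y p).Avoids a ↔ a ≠ y := by
  simp [sumLoop, avoids_forLt, Prog.Avoids, Instr.Avoids]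

/-- An operand addressed by `rK` runs along its array, while any other register selects a fixed
entry; this is the case distinction in `hf`. -/
theorem runs_vec {op : RatOp} {a e i c k : ℕ} (f : ℕ → ℚ) (hN : n ≤ N) (hb : n ≤ b)
    (ho : σ.idx (rO s) = 1) (hB : σ.idx B = n) (hBK : B ≠ rK s) (hae : e ≠ a) (hac : c ≠ a)
    (hf : ∀ l < n, op.apply (σ.mem e (if i = rK s then l else σ.idx i))
      (σ.mem c (if k = rK s then l else σ.idx k)) = f l)
    (hs : ∀ l < n, ratSize (f l) ≤ b) :
    Runs b N (vec s B op a e i c k) σ fun τ => ∀ l < n, τ.mem a l = f l := by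
  refine (Runs.forLt (fun i τ => ∀ l < i, τ.mem a l = f l) hN hb ho hB (by simp) hBK
    (by simp [Prog.KeepsReg, Instr.KeepsReg]) (by simp [Prog.KeepsReg, Instr.KeepsReg])
    (by simp [Prog.KeepsReg, Instr.KeepsReg]) (by simp) ?_).imp fun τ hτ _ => hτ.1
  intro l hl σ' hI hr hfr
  have hidx : ∀ r, σ'.idx r = if r = rK s then l else σ.idx r := by
    intro r
    split_ifs with h
    · rw [h, hr]
    · exact hfr.idx r (keepsReg_vec.2 h)
  have hv : op.apply (σ'.mem e (σ'.idx i)) (σ'.mem c (σ'.idx k)) = f l := by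
    rw [hidx i, hidx k, hfr.mem e (avoids_vec.2 hae), hfr.mem c (avoids_vec.2 hac), hf l hl]
  refine Runs.instr ?_ ?_
  · simp only [Instr.outSize, hv]; exact hs l hl
  · intro l' hl'
    simp only [Instr.apply, setIdx_mem, setMem_mem, hv, hr, true_and]
    split_ifs with h
    · rw [h]
    · exact hI l' (by omega)

theorem runs_overrideLoop {x r : ℕ} (hN : n ≤ N) (hb : n ≤ b) (hb7 : 7 ≤ b)
    (ho : σ.idx (rO s) = 1) (hz : σ.idx (rZ s) = 0) (hz' : σ.mem (aSgn s q) 0 = 0)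
    (hB : σ.idx B = n) (hBK : B ≠ rK s) (hrx : r ≠ x) (hx : aSgn s q ≠ x)
    (hs : ∀ l < n, σ.mem x l = 0 ∨ σ.mem x l = 1) :
    Runs b N (overrideLoop s q B x r) σ
      fun τ => ∀ l < n, τ.mem x l = override (σ.mem r l) (σ.mem x l) := by
  -- The array is overwritten in place, so the invariant also records that entries not yet reached
  -- are unchanged.
  refine (Runs.forLt (fun i τ => (∀ l < i, τ.mem x l = override (σ.mem r l) (σ.mem x l)) ∧
      ∀ l, i ≤ l → τ.mem x l = σ.mem x l) hN hb ho hB (by simp) hBK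
    (by simp [Prog.KeepsReg, Instr.KeepsReg]) (by simp [Prog.KeepsReg, Instr.KeepsReg])
    (by simp [Prog.KeepsReg, Instr.KeepsReg]) (by simp [setIdx_mem]) ?_).imp fun τ hτ _ => hτ.1.1
  intro l hl σ' hI hr hfr
  have e1 : σ'.idx (rZ s) = 0 := by
    rw [hfr.idx _ (keepsReg_overrideLoop.2 (by simp)), hz]
  have e2 : σ'.mem (aSgn s q) = σ.mem (aSgn s q) := hfr.mem _ (avoids_overrideLoop.2 hx)
  have e3 : σ'.mem r = σ.mem r := hfr.mem _ (avoids_overrideLoop.2 hrx)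
  have e4 : σ'.mem x l = σ.mem x l := hI.2 l le_rfl
  have key : ∀ τ : State, τ = σ'.setMem x l (override (σ.mem r l) (σ.mem x l)) →
      (∀ l' < l + 1, (τ.setIdx (rK s) (l + 1)).mem x l' = override (σ.mem r l') (σ.mem x l')) ∧
      ∀ l', l + 1 ≤ l' → (τ.setIdx (rK s) (l + 1)).mem x l' = σ.mem x l' := by
    rintro _ rfl
    simp only [setIdx_mem, setMem_mem, true_and]
    constructor
    · intro l' hl'
      split_ifs with h
      · rw [h]
      · exact hI.1 l' (by omega)
    · intro l' hl'
      rw [if_neg (by omega)]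
      exact hI.2 l' (by omega)
  refine Runs.ite (fun hc => Runs.instr ?_ (key _ ?_)) fun hc => Runs.ite
    (fun hc' => Runs.instr ?_ (key _ ?_)) fun hc' => Runs.instr ?_ (key _ ?_)
  · exact ((fits_zero 0).ratSize_le).trans (by omega)
  · simp only [Test.Holds, e1, e2, e3, hz', hr] at hc
    simp [Instr.apply, hr, override, hc]
  · exact ((fits_one 0).ratSize_le).trans (by omega)
  · simp only [Test.Holds, e1, e2, e3, hz', hr] at hc hc'
    simp [Instr.apply, hr, override, hc, hc']
  · simp only [Instr.outSize, RatOp.apply, e1, e2, hz', hr, e4, add_zero]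
    rcases hs l hl with h | h <;> rw [h]
    · exact ((fits_zero 0).ratSize_le).trans (by omega)
    · exact ((fits_one 0).ratSize_le).trans (by omega)
  · simp only [Test.Holds, e1, e2, e3, hz', hr] at hc hc'
    simp [Instr.apply, RatOp.apply, hr, override, hc, hc', e1, e2, e4, hz']

theorem runs_sumLoop {y p : ℕ} {f : ℕ → ℚ} (hN : n ≤ N) (hb : n ≤ b)
    (ho : σ.idx (rO s) = 1) (hz : σ.idx (rZ s) = 0) (hB : σ.idx B = n) (hBK : B ≠ rK s)
    (hpy : p ≠ y) (hf : ∀ l < n, σ.mem p l = f l)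
    (hs : ∀ l ≤ n, ratSize (∑ k ∈ range l, f k) ≤ b) :
    Runs b N (sumLoop s B y p) σ fun τ => τ.mem y 0 = ∑ k ∈ range n, f k := by
  refine Runs.seq (Mid := fun τ => τ.mem y 0 = 0) (Runs.instr ?_ ?_) fun τ hτ hfr0 => ?_
  · simpa [Instr.outSize] using hs 0 (Nat.zero_le _)
  · simp [Instr.apply, setMem_mem, hz]
  have hidx : ∀ r, τ.idx r = σ.idx r := fun r => hfr0.idx r (by simp [Prog.KeepsReg, Instr.KeepsReg])
  refine (Runs.forLt (fun i τ => τ.mem y 0 = ∑ k ∈ range i, f k) hN hb (by rw [hidx, ho])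
    (by rw [hidx, hB]) (by simp) hBK
    (by simp [Prog.KeepsReg, Instr.KeepsReg]) (by simp [Prog.KeepsReg, Instr.KeepsReg])
    (by simp [Prog.KeepsReg, Instr.KeepsReg]) (by simpa [setIdx_mem] using hτ) ?_).imp
    fun τ hτ _ => hτ.1
  intro l hl σ' hI hr hfr
  have e1 : σ'.idx (rZ s) = 0 := by
    rw [hfr.idx _ (keepsReg_forLt.2 (by simp [Prog.KeepsReg, Instr.KeepsReg])), hidx, hz]
  have e2 : σ'.mem p l = f l := by
    rw [hfr.mem p (avoids_forLt.2 (by simp [Prog.Avoids, Instr.Avoids, hpy])),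
      hfr0.mem p (by simp [Prog.Avoids, Instr.Avoids, hpy]), hf l hl]
  refine Runs.instr ?_ ?_
  · simp only [Instr.outSize, RatOp.apply, e1, hr, hI, e2, ← sum_range_succ]
    exact hs _ hl
  · simp only [Instr.apply, RatOp.apply, setIdx_mem, setMem_mem, e1, hr, hI, e2,
      ← sum_range_succ, and_self, if_true]

end BoolSearch

namespace BoolSearch

open Finset StrongPoly

/-! ### Evaluation of the candidates given by the registers -/

section Programs

variable (s q : ℕ)

/-- The coefficients in the objective function. -/
def coeff (p : ℕ) : ℚ := if p = 0 then 1 else -2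

/-- Processing of the `i`-th pivot of the `j`-th candidate. -/
def stage (j i : ℕ) : Prog :=
  .seq (vec s j .mul (aR s q) (aW s q j i i) (rK s) (aSgn s q) (signReg s j i))
    (.seq (overrideLoop s q j (aX s q j) (aR s q))
      (.seq (vec s j .div (aQ s q) (aW s q j i i) (rK s) (aW s q j i i) (pivotReg s j i))
        (rep (rK s) (fun p =>
          .seq (vec s j .mul (aS s q) (aQ s q) (rK s) (aW s q j i p) (pivotReg s j i))
            (vec s j .sub (aW s q j (i + 1) p) (aW s q j i p) (rK s) (aS s q) (rK s))) (q + 1))))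

/-- Computation of the `j`-th candidate. -/
def makeCandidate (j : ℕ) : Prog :=
  .seq (vec s j .add (aX s q j) (aSgn s q) (rZ s) (aSgn s q) (rZ s))
    (.seq (rep (rK s) (stage s q j) (q + 1)) (.instr (.ratConst (aX s q j) (starReg s j) 1)))

/-- Multiplication of the products by the linear forms in the `j`-th candidate. -/
def multiply (j : ℕ) : Prog :=
  rep (rK s) (fun p => .seq
    (vec s j .mul (aP s q) (aW s q j 0 p) (rK s) (aX s q j) (rK s))
    (.seq (sumLoop s j (aY s q) (aP s q))
      (.instr (.ratArith .mul (aZ s q p) (rZ s) (aZ s q p) (rZ s) (aY s q) (rZ s))))) (q + 1)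

/-- Computation of the candidates and of the objective function. -/
def evaluate : Prog :=
  .seq (rep (rK s) (fun p => .instr (.ratConst (aZ s q p) (rZ s) (coeff p))) (q + 1))
    (.seq (rep (rK s) (fun j => .seq (makeCandidate s q j) (multiply s q j)) s)
      (.seq (.instr (.ratConst (aObj s q) (rZ s) 0))
        (rep (rK s) (fun p => .instr
          (.ratArith .add (aObj s q) (rZ s) (aObj s q) (rZ s) (aZ s q p) (rZ s))) (q + 1))))

end Programs

/-- A bound for the encoding lengths, after `t` operations on numbers that arise as sums. -/
def grow (M t : ℕ) : ℕ :=
  (fun m => 4 * m + 1)^[t] ((4 * M + 1) + (4 * M + 1) + (4 * M + 1) * (4 * M + 1))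

theorem grow_succ (M t : ℕ) : grow M (t + 1) = 4 * grow M t + 1 := by
  simp only [grow, Function.iterate_succ_apply']

theorem grow_mono (M : ℕ) : Monotone (grow M) :=
  monotone_nat_of_le_succ fun t => by rw [grow_succ]; omega

theorem le_grow (M t : ℕ) : 4 * M + 2 ≤ grow M t :=
  le_trans (by simp only [grow, Function.iterate_zero, id]; nlinarith) (grow_mono M (Nat.zero_le t))

/-- The assumptions on the contents `c` of the registers and on the data. -/
structure Setup (s q b N M : ℕ) (n : ℕ → ℕ) (v : ℕ → ℕ → ℕ → ℚ) (c : ℕ → ℕ) : Prop where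
  dim : ∀ j < s, c j = n j
  zero : c (rZ s) = 0
  one : c (rO s) = 1
  pivot : ∀ j < s, ∀ i < q + 1, c (pivotReg s j i) < n j
  sign : ∀ j < s, ∀ i < q + 1, c (signReg s j i) < 3
  star : ∀ j < s, c (starReg s j) < n j
  le_M : ∀ j < s, n j ≤ M
  le_N : ∀ j < s, n j ≤ N
  fits : ∀ j < s, ∀ p < q + 1, ∀ k < n j, Fits M (v j p k)
  bound : 2 * grow M (3 * q + s + q + 7) + 3 ≤ b

/-- The registers, the signs and the data are in place. -/
structure Ready (s q : ℕ) (n : ℕ → ℕ) (v : ℕ → ℕ → ℕ → ℚ) (c : ℕ → ℕ) (σ : State) : Prop where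
  idx : ∀ r, r ≠ rK s → σ.idx r = c r
  sgn : ∀ i < 3, σ.mem (aSgn s q) i = sgn i
  data : ∀ j < s, ∀ p < q + 1, ∀ k < n j, σ.mem (aW s q j 0 p) k = v j p k

/-- The program does not spoil what `Ready` says. -/
structure Tame (s q : ℕ) (P : Prog) : Prop where
  keepsReg : ∀ r, r ≠ rK s → P.KeepsReg r
  sgn : P.Avoids (aSgn s q)
  data : ∀ j p, P.Avoids (aW s q j 0 p)

variable {s q b N M : ℕ} {n : ℕ → ℕ} {v : ℕ → ℕ → ℕ → ℚ} {c : ℕ → ℕ} {σ τ : State}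

/-! ### Preservation of constants, signs and data -/

theorem Ready.frame (h : Ready s q n v c σ) {P : Prog} (hP : Tame s q P) (hf : Frame P σ τ) :
    Ready s q n v c τ where
  idx r hr := by rw [hf.idx r (hP.keepsReg r hr), h.idx r hr]
  sgn i hi := by rw [hf.mem _ hP.sgn, h.sgn i hi]
  data j hj p hp k hk := by rw [hf.mem _ (hP.data j p), h.data j hj p hp k hk]

theorem tame_vec {B : ℕ} {op : RatOp} {a e i f k : ℕ} (h : aSgn s q ≠ a)
    (h' : ∀ j p, aW s q j 0 p ≠ a) : Tame s q (vec s B op a e i f k) :=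
  ⟨fun _ hr => keepsReg_vec.2 hr, avoids_vec.2 h, fun j p => avoids_vec.2 (h' j p)⟩

theorem tame_overrideLoop {B x r : ℕ} (h : aSgn s q ≠ x)
    (h' : ∀ j p, aW s q j 0 p ≠ x) : Tame s q (overrideLoop s q B x r) :=
  ⟨fun _ hr => keepsReg_overrideLoop.2 hr, avoids_overrideLoop.2 h,
    fun j p => avoids_overrideLoop.2 (h' j p)⟩

theorem tame_sumLoop {B y p : ℕ} (h : aSgn s q ≠ y)
    (h' : ∀ j p, aW s q j 0 p ≠ y) : Tame s q (sumLoop s B y p) :=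
  ⟨fun _ hr => keepsReg_sumLoop.2 hr, avoids_sumLoop.2 h, fun j p => avoids_sumLoop.2 (h' j p)⟩

theorem tame_ratConst {a i : ℕ} {x : ℚ} (h : aSgn s q ≠ a)
    (h' : ∀ j p, aW s q j 0 p ≠ a) : Tame s q (.instr (.ratConst a i x)) :=
  ⟨fun _ _ => trivial, h, h'⟩

theorem tame_ratArith {op : RatOp} {a i e j f k : ℕ} (h : aSgn s q ≠ a)
    (h' : ∀ j p, aW s q j 0 p ≠ a) : Tame s q (.instr (.ratArith op a i e j f k)) :=
  ⟨fun _ _ => trivial, h, h'⟩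

theorem Tame.seq {P Q : Prog} (hP : Tame s q P) (hQ : Tame s q Q) : Tame s q (.seq P Q) :=
  ⟨fun r hr => ⟨hP.1 r hr, hQ.1 r hr⟩, ⟨hP.2, hQ.2⟩, fun j p => ⟨hP.3 j p, hQ.3 j p⟩⟩

theorem Tame.ite {t : Test} {P Q : Prog} (hP : Tame s q P) (hQ : Tame s q Q) :
    Tame s q (.ite t P Q) :=
  ⟨fun r hr => ⟨hP.1 r hr, hQ.1 r hr⟩, ⟨hP.2, hQ.2⟩, fun j p => ⟨hP.3 j p, hQ.3 j p⟩⟩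

theorem Tame.rep {f : ℕ → Prog} {m : ℕ} (h : ∀ i, Tame s q (f i)) :
    Tame s q (rep (rK s) f m) :=
  ⟨fun r hr => keepsReg_rep.2 ⟨hr, fun i _ => (h i).1 r hr⟩, avoids_rep.2 fun i _ => (h i).2,
    fun j p => avoids_rep.2 fun i _ => (h i).3 j p⟩

theorem tame_stage (j i : ℕ) : Tame s q (stage s q j i) :=
  (tame_vec (by simp) (by simp)).seq ((tame_overrideLoop (by simp) (by simp)).seq
    ((tame_vec (by simp) (by simp)).seq (Tame.rep fun p =>
      (tame_vec (by simp) (by simp)).seq (tame_vec (by simp) (by simp)))))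

theorem tame_makeCandidate (j : ℕ) : Tame s q (makeCandidate s q j) :=
  (tame_vec (by simp) (by simp)).seq
    ((Tame.rep fun i => tame_stage j i).seq (tame_ratConst (by simp) (by simp)))

theorem tame_multiply (j : ℕ) : Tame s q (multiply s q j) :=
  Tame.rep fun _ => (tame_vec (by simp) (by simp)).seq
    ((tame_sumLoop (by simp) (by simp)).seq (tame_ratArith (by simp) (by simp)))

theorem tame_evaluate : Tame s q (evaluate s q) :=
  (Tame.rep fun _ => tame_ratConst (by simp) (by simp)).seq
    ((Tame.rep fun j => (tame_makeCandidate j).seq (tame_multiply j)).seq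
      ((tame_ratConst (by simp) (by simp)).seq
        (Tame.rep fun _ => tame_ratArith (by simp) (by simp))))

/-! ### Encoding lengths during the elimination -/

namespace Setup

theorem ratSize_le (h : Setup s q b N M n v c) {t : ℕ} {x : ℚ} (hx : Fits (grow M t) x)
    (ht : t ≤ 3 * q + s + q + 7) : ratSize x ≤ b :=
  hx.ratSize_le.trans (le_trans (by have := grow_mono M ht; omega) h.bound)

theorem le_b (h : Setup s q b N M n v c) {j : ℕ} (hj : j < s) : n j ≤ b := by
  have := h.bound
  have := le_grow M (3 * q + s + q + 7)
  have := h.le_M j hj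
  omega

theorem seven_le (h : Setup s q b N M n v c) : 7 ≤ b := by
  have := h.bound
  have := le_grow M (3 * q + s + q + 7)
  omega

/-- One elimination is a division, a multiplication and a subtraction, hence three steps of `grow`.
The total is at most `3 * (q + 1)` and does not depend on the dimensions. -/
theorem fits_elim (h : Setup s q b N M n v c) {j : ℕ} (hj : j < s) {i : ℕ} (hi : i ≤ q + 1) :
    ∀ p < q + 1, ∀ k < n j,
      Fits (grow M (3 * i)) (elim (v j) (fun i => c (pivotReg s j i)) i p k) := by
  induction i with
  | zero => exact fun p hp k hk => (h.fits j hj p hp k hk).mono (by have := le_grow M (3 * 0); omega)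
  | succ i ih =>
    intro p hp k hk
    have ih := ih (by omega)
    have hκ := h.pivot j hj i (by omega)
    have h1 := Fits.op .div (ih i (by omega) k hk) (ih i (by omega) _ hκ)
    have h2 := Fits.op .mul h1 ((ih p hp _ hκ).mono (by omega))
    have h3 := Fits.op .sub ((ih p hp k hk).mono (by omega)) h2
    simp only [← grow_succ] at h3
    exact h3

end Setup

theorem fits_sgn (m i : ℕ) : Fits m (sgn i) := by
  unfold sgn
  split
  · exact fits_one m
  · exact (fits_one m).neg
  · exact fits_zero m

theorem sgn_zero : sgn 0 = 0 := rfl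

theorem avoids_stage {j i a : ℕ} (h1 : a ≠ aR s q) (h2 : a ≠ aX s q j) (h3 : a ≠ aQ s q)
    (h4 : a ≠ aS s q) (h5 : ∀ p, a ≠ aW s q j (i + 1) p) : (stage s q j i).Avoids a :=
  ⟨avoids_vec.2 h1, avoids_overrideLoop.2 h2, avoids_vec.2 h3,
    avoids_rep.2 fun p _ => ⟨avoids_vec.2 h4, avoids_vec.2 (h5 p)⟩⟩

theorem avoids_makeCandidate {j a : ℕ} (h1 : a ≠ aR s q) (h2 : a ≠ aX s q j) (h3 : a ≠ aQ s q)
    (h4 : a ≠ aS s q) (h5 : ∀ i p, a ≠ aW s q j (i + 1) p) : (makeCandidate s q j).Avoids a :=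
  ⟨avoids_vec.2 h2, avoids_rep.2 fun i _ => avoids_stage h1 h2 h3 h4 (h5 i), h2⟩

theorem avoids_multiply {j a : ℕ} (h1 : a ≠ aP s q) (h2 : a ≠ aY s q) (h3 : ∀ p, a ≠ aZ s q p) :
    (multiply s q j).Avoids a :=
  avoids_rep.2 fun p _ => ⟨avoids_vec.2 h1, avoids_sumLoop.2 h2, h3 p⟩

/-- The quotient by the pivot entry is computed once and shared by all `p`. Coordinates `p ≤ i` are
transformed too, for uniformity, but no longer influence the pattern. -/
theorem runs_stage (h : Setup s q b N M n v c) (hσ : Ready s q n v c σ) {j i : ℕ} (hj : j < s)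
    (hi : i < q + 1)
    (hW : ∀ p < q + 1, ∀ k < n j, σ.mem (aW s q j i p) k =
      elim (v j) (fun i => c (pivotReg s j i)) i p k)
    (hX : ∀ k < n j, σ.mem (aX s q j) k =
      pattern (v j) (fun i => c (pivotReg s j i)) (fun i => c (signReg s j i)) i k) :
    Runs b N (stage s q j i) σ fun τ =>
      (∀ p < q + 1, ∀ k < n j, τ.mem (aW s q j (i + 1) p) k =
        elim (v j) (fun i => c (pivotReg s j i)) (i + 1) p k) ∧
      ∀ k < n j, τ.mem (aX s q j) k =
        pattern (v j) (fun i => c (pivotReg s j i)) (fun i => c (signReg s j i)) (i + 1) k := by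
  set κ : ℕ → ℕ := fun i => c (pivotReg s j i) with hκ
  have hκi : κ i < n j := h.pivot j hj i hi
  have hE := h.fits_elim hj hi.le
  have hjK : j ≠ rK s := ne_reg hj
  have idxO : ∀ {τ}, Ready s q n v c τ → τ.idx (rO s) = 1 := fun hτ => by
    rw [hτ.idx _ (by simp), h.one]
  have idxJ : ∀ {τ}, Ready s q n v c τ → τ.idx j = n j := fun hτ => by
    rw [hτ.idx _ hjK, h.dim j hj]
  have idxP : ∀ {τ}, Ready s q n v c τ → τ.idx (pivotReg s j i) = κ i := fun hτ =>
    hτ.idx _ (by simp)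
  unfold stage
  have t1 : Tame s q (vec s j .mul (aR s q) (aW s q j i i) (rK s) (aSgn s q) (signReg s j i)) :=
    tame_vec (by simp) (by simp)
  refine Runs.seq (runs_vec (fun k => elim (v j) κ i i k * sgn (c (signReg s j i)))
    (h.le_N j hj) (h.le_b hj) (idxO hσ) (idxJ hσ) hjK (by simp) (by simp) (fun k hk => ?_)
    fun k hk => ?_) fun σ₁ h₁ f₁ => ?_
  · simp only [if_true, RatOp.apply, reg_inj, OfNat.ofNat_ne_zero, false_and, if_false]
    rw [hW i hi k hk, hσ.idx _ (by simp), hσ.sgn _ (h.sign j hj i hi)]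
  · refine h.ratSize_le (t := 3 * i + 1) ?_ (by omega)
    rw [grow_succ]
    exact Fits.op .mul (hE i hi k hk) (fits_sgn _ _)
  have r₁ := hσ.frame t1 f₁
  have hX₁ : ∀ k < n j, σ₁.mem (aX s q j) k = pattern (v j) κ _ i k := fun k hk => by
    rw [f₁.mem _ (avoids_vec.2 (by simp)), hX k hk]
  have t2 : Tame s q (overrideLoop s q j (aX s q j) (aR s q)) :=
    tame_overrideLoop (by simp) (by simp)
  refine Runs.seq (runs_overrideLoop (h.le_N j hj) (h.le_b hj) h.seven_le (idxO r₁)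
    (by rw [r₁.idx _ (by simp), h.zero]) (by rw [r₁.sgn 0 (by norm_num), sgn_zero]) (idxJ r₁) hjK
    (by simp) (by simp) fun k hk => ?_) fun σ₂ h₂ f₂ => ?_
  · rw [hX₁ k hk]; exact pattern_binary _ _ _ _ _
  have r₂ := r₁.frame t2 f₂
  have hX₂ : ∀ k < n j, σ₂.mem (aX s q j) k =
      pattern (v j) κ (fun i => c (signReg s j i)) (i + 1) k := fun k hk => by
    rw [h₂ k hk, hX₁ k hk, h₁ k hk, pattern]
  have hW₂ : ∀ p < q + 1, ∀ k < n j, σ₂.mem (aW s q j i p) k = elim (v j) κ i p k :=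
    fun p hp k hk => by
      rw [f₂.mem _ (avoids_overrideLoop.2 (by simp)), f₁.mem _ (avoids_vec.2 (by simp)),
        hW p hp k hk]
  have t3 : Tame s q (vec s j .div (aQ s q) (aW s q j i i) (rK s) (aW s q j i i)
      (pivotReg s j i)) := tame_vec (by simp) (by simp)
  have hQ : ∀ k < n j, Fits (grow M (3 * i + 1)) (elim (v j) κ i i k / elim (v j) κ i i (κ i)) :=
    fun k hk => by
      rw [grow_succ]
      exact Fits.op .div (hE i hi k hk) (hE i hi _ hκi)
  refine Runs.seq (runs_vec (fun k => elim (v j) κ i i k / elim (v j) κ i i (κ i))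
    (h.le_N j hj) (h.le_b hj) (idxO r₂) (idxJ r₂) hjK (by simp) (by simp) (fun k hk => ?_)
    fun k hk => h.ratSize_le (hQ k hk) (by omega)) fun σ₃ h₃ f₃ => ?_
  · simp only [if_true, RatOp.apply, reg_inj, OfNat.ofNat_ne_zero, false_and, if_false]
    rw [hW₂ i hi k hk, idxP r₂, hW₂ i hi _ hκi]
  have r₃ := r₂.frame t3 f₃
  have t4 : ∀ p, Tame s q (.seq (vec s j .mul (aS s q) (aQ s q) (rK s) (aW s q j i p)
      (pivotReg s j i)) (vec s j .sub (aW s q j (i + 1) p) (aW s q j i p) (rK s) (aS s q) (rK s))) :=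
    fun p => (tame_vec (by simp) (by simp)).seq (tame_vec (by simp) (by simp))
  refine (Runs.rep (fun m τ => ∀ p < m, ∀ k < n j, τ.mem (aW s q j (i + 1) p) k =
    elim (v j) κ (i + 1) p k) (by simp) fun p hp σ' hI f' => ?_).imp fun τ hτ f' => ⟨hτ, ?_⟩
  · have r' := r₃.frame (Tame.rep t4) f'
    have hQ' : ∀ k < n j, σ'.mem (aQ s q) k = elim (v j) κ i i k / elim (v j) κ i i (κ i) :=
      fun k hk => by
        rw [f'.mem _ (avoids_rep.2 fun p _ => ⟨avoids_vec.2 (by simp), avoids_vec.2 (by simp)⟩),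
          h₃ k hk]
    have hW' : ∀ k < n j, σ'.mem (aW s q j i p) k = elim (v j) κ i p k := fun k hk => by
      rw [f'.mem _ (avoids_rep.2 fun p _ => ⟨avoids_vec.2 (by simp), avoids_vec.2 (by simp)⟩),
        f₃.mem _ (avoids_vec.2 (by simp)), hW₂ p hp k hk]
    have t5 : Tame s q (vec s j .mul (aS s q) (aQ s q) (rK s) (aW s q j i p) (pivotReg s j i)) :=
      tame_vec (by simp) (by simp)
    have hS : ∀ k < n j, Fits (grow M (3 * i + 2))
        (elim (v j) κ i i k / elim (v j) κ i i (κ i) * elim (v j) κ i p (κ i)) := fun k hk => by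
      rw [grow_succ]
      exact Fits.op .mul (hQ k hk) ((hE p hp _ hκi).mono (grow_mono M (by omega)))
    refine Runs.seq (runs_vec
      (fun k => elim (v j) κ i i k / elim (v j) κ i i (κ i) * elim (v j) κ i p (κ i))
      (h.le_N j hj) (h.le_b hj) (idxO r') (idxJ r') hjK (by simp) (by simp) (fun k hk => ?_)
      fun k hk => h.ratSize_le (hS k hk) (by omega)) fun σ₄ h₄ f₄ => ?_
    · simp only [if_true, RatOp.apply, reg_inj, OfNat.ofNat_ne_zero, false_and, if_false]
      rw [hQ' k hk, idxP r', hW' _ hκi]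
    have r₄ := r'.frame t5 f₄
    refine (runs_vec (fun k => elim (v j) κ (i + 1) p k)
      (h.le_N j hj) (h.le_b hj) (idxO r₄) (idxJ r₄) hjK (by simp) (by simp) (fun k hk => ?_)
      fun k hk => h.ratSize_le (t := 3 * (i + 1)) (h.fits_elim hj hi p hp k hk) (by omega)).imp
      fun τ hτ f₅ => ?_
    · simp only [if_true, RatOp.apply]
      rw [f₄.mem _ (avoids_vec.2 (by simp)), hW' k hk, h₄ k hk, elim]
    · intro p' hp' k hk
      rcases Nat.lt_succ_iff_lt_or_eq.1 hp' with hlt | rfl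
      · rw [f₅.mem _ (avoids_vec.2 (by simp [hlt.ne])), f₄.mem _ (avoids_vec.2 (by simp)),
          hI p' hlt k hk]
      · exact hτ k hk
  · intro k hk
    rw [f'.mem _ (avoids_rep.2 fun p _ => ⟨avoids_vec.2 (by simp), avoids_vec.2 (by simp)⟩),
      f₃.mem _ (avoids_vec.2 (by simp)), hX₂ k hk]

/-- The candidate given by the contents `c` of the registers. -/
def cand (s q : ℕ) (v : ℕ → ℕ → ℕ → ℚ) (c : ℕ → ℕ) (j : ℕ) : ℕ → ℚ :=
  candidate (v j) (q + 1) (fun i => c (pivotReg s j i)) (fun i => c (signReg s j i))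
    (c (starReg s j))

theorem runs_makeCandidate (h : Setup s q b N M n v c) (hσ : Ready s q n v c σ) {j : ℕ}
    (hj : j < s) :
    Runs b N (makeCandidate s q j) σ fun τ => ∀ k < n j, τ.mem (aX s q j) k = cand s q v c j k := by
  have hjK : j ≠ rK s := ne_reg hj
  unfold makeCandidate
  refine Runs.seq (runs_vec (fun _ => 0) (h.le_N j hj) (h.le_b hj)
    (by rw [hσ.idx _ (by simp), h.one]) (by rw [hσ.idx _ hjK, h.dim j hj]) hjK (by simp) (by simp)
    (fun k hk => ?_) fun k hk => h.ratSize_le (t := 0) (fits_zero _) (by omega))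
    fun σ₁ h₁ f₁ => ?_
  · simp only [RatOp.apply, reg_inj, one_ne_zero, false_and, if_false]
    rw [hσ.idx _ (by simp), h.zero, hσ.sgn 0 (by norm_num), sgn_zero, add_zero]
  have r₁ := hσ.frame (tame_vec (by simp) (by simp)) f₁
  refine Runs.seq (Runs.rep (fun i τ => (∀ p < q + 1, ∀ k < n j, τ.mem (aW s q j i p) k =
        elim (v j) (fun i => c (pivotReg s j i)) i p k) ∧
      ∀ k < n j, τ.mem (aX s q j) k =
        pattern (v j) (fun i => c (pivotReg s j i)) (fun i => c (signReg s j i)) i k)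
    ⟨fun p hp k hk => r₁.data j hj p hp k hk, h₁⟩ fun i hi σ' hI f' =>
      runs_stage h (r₁.frame (Tame.rep (tame_stage j)) f') hj hi hI.1 hI.2) fun σ₂ h₂ f₂ => ?_
  have r₂ := r₁.frame (Tame.rep (tame_stage j)) f₂
  refine Runs.instr (h.ratSize_le (t := 0) (fits_one _) (by omega)) fun k hk => ?_
  simp only [Instr.apply, setMem_mem, true_and, cand, candidate]
  rw [r₂.idx _ (by simp), h₂.2 k hk]

/-- The linear forms in the candidates. -/
def form (s q : ℕ) (n : ℕ → ℕ) (v : ℕ → ℕ → ℕ → ℚ) (c : ℕ → ℕ) (j p : ℕ) : ℚ :=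
  ∑ k ∈ range (n j), v j p k * cand s q v c j k

/-- The partial products in the objective function. -/
def term (s q : ℕ) (n : ℕ → ℕ) (v : ℕ → ℕ → ℕ → ℚ) (c : ℕ → ℕ) (j p : ℕ) : ℚ :=
  coeff p * ∏ i ∈ range j, form s q n v c i p

theorem fits_cand (m j k : ℕ) : Fits m (cand s q v c j k) := by
  rcases candidate_binary (v j) (q + 1) (fun i => c (pivotReg s j i))
    (fun i => c (signReg s j i)) (c (starReg s j)) k with h | h <;> unfold cand <;> rw [h]
  · exact fits_zero m
  · exact fits_one m

namespace Setup

theorem fits_mul_cand (h : Setup s q b N M n v c) {j p k : ℕ} (hj : j < s) (hp : p < q + 1)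
    (hk : k < n j) : Fits (4 * M + 1) (v j p k * cand s q v c j k) :=
  (h.fits j hj p hp k hk).mul (fits_cand M j k)

theorem fits_partial (h : Setup s q b N M n v c) {j p l : ℕ} (hj : j < s) (hp : p < q + 1)
    (hl : l ≤ n j) : Fits (grow M 0) (∑ k ∈ range l, v j p k * cand s q v c j k) := by
  refine (fits_sum fun k hk => h.fits_mul_cand hj hp (by omega)).mono ?_
  -- With both the number of summands and their size at most `4 * M + 1`, the bound of `fits_sum` is
  -- at most the initial value of `grow`.
  have : l ≤ 4 * M + 1 := by have := h.le_M j hj; omega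
  simp only [grow, Function.iterate_zero, id]
  gcongr

theorem fits_term (h : Setup s q b N M n v c) {j p : ℕ} (hj : j ≤ s) (hp : p < q + 1) :
    Fits (grow M j) (term s q n v c j p) := by
  induction j with
  | zero =>
    simp only [term, range_zero, prod_empty, mul_one, coeff]
    have h2 : Fits 1 (2 : ℚ) := by norm_num [Fits]
    split_ifs
    · exact fits_one _
    · exact h2.neg.mono (by have := le_grow M 0; omega)
  | succ j ih =>
    simp only [term, prod_range_succ, ← mul_assoc]
    rw [grow_succ]
    exact (ih (by omega)).mul
      ((h.fits_partial (by omega) hp le_rfl).mono (grow_mono M (Nat.zero_le _)))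

theorem fits_sum_term (h : Setup s q b N M n v c) {m : ℕ} (hm : m ≤ q + 1) :
    Fits (grow M (s + m)) (∑ p ∈ range m, term s q n v c s p) := by
  induction m with
  | zero => exact fits_zero _
  | succ m ih =>
    rw [sum_range_succ, ← add_assoc, grow_succ]
    exact (ih (by omega)).add ((h.fits_term le_rfl (by omega)).mono (grow_mono M (by omega)))

end Setup

/-- The forms are evaluated with the original vectors in `aW j 0 p`, which the elimination has left
intact. -/
theorem runs_multiply (h : Setup s q b N M n v c) (hσ : Ready s q n v c σ) {j : ℕ} (hj : j < s)
    (hX : ∀ k < n j, σ.mem (aX s q j) k = cand s q v c j k)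
    (hZ : ∀ p < q + 1, σ.mem (aZ s q p) 0 = term s q n v c j p) :
    Runs b N (multiply s q j) σ
      fun τ => ∀ p < q + 1, τ.mem (aZ s q p) 0 = term s q n v c (j + 1) p := by
  have hjK : j ≠ rK s := ne_reg hj
  refine (Runs.rep (fun m τ => ∀ p < q + 1, τ.mem (aZ s q p) 0 =
    if p < m then term s q n v c (j + 1) p else term s q n v c j p) (by simpa using hZ)
    fun p hp σ' hI f' => ?_).imp fun τ hτ _ p hp => by rw [hτ p hp, if_pos hp]
  have r' := hσ.frame (tame_multiply j) f'
  have e1 : ∀ {τ}, Ready s q n v c τ → τ.idx (rO s) = 1 := fun hτ => by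
    rw [hτ.idx _ (by simp), h.one]
  have e2 : ∀ {τ}, Ready s q n v c τ → τ.idx j = n j := fun hτ => by
    rw [hτ.idx _ hjK, h.dim j hj]
  have e3 : ∀ {τ}, Ready s q n v c τ → τ.idx (rZ s) = 0 := fun hτ => by
    rw [hτ.idx _ (by simp), h.zero]
  refine Runs.seq (runs_vec (fun k => v j p k * cand s q v c j k) (h.le_N j hj) (h.le_b hj)
    (e1 r') (e2 r') hjK (by simp) (by simp) (fun k hk => ?_) fun k hk =>
      h.ratSize_le (t := 0) ((h.fits_mul_cand hj hp hk).mono ?_) (by omega)) fun σ₁ h₁ f₁ => ?_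
  · simp only [if_true, RatOp.apply]
    rw [r'.data j hj p hp k hk, f'.mem _ (avoids_multiply (by simp) (by simp) (by simp)), hX k hk]
  · have := le_grow M 0
    omega
  have r₁ := r'.frame (tame_vec (by simp) (by simp)) f₁
  refine Runs.seq (runs_sumLoop (h.le_N j hj) (h.le_b hj) (e1 r₁) (e3 r₁) (e2 r₁) hjK (by simp) h₁
    fun l hl => h.ratSize_le (h.fits_partial hj hp hl) (by omega)) fun σ₂ h₂ f₂ => ?_
  have r₂ := r₁.frame (tame_sumLoop (by simp) (by simp)) f₂
  have hZ₂ : ∀ p', σ₂.mem (aZ s q p') = σ'.mem (aZ s q p') := fun p' => by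
    rw [f₂.mem _ (avoids_sumLoop.2 (by simp)), f₁.mem _ (avoids_vec.2 (by simp))]
  have hval : RatOp.mul.apply (σ₂.mem (aZ s q p) (σ₂.idx (rZ s))) (σ₂.mem (aY s q) (σ₂.idx (rZ s)))
      = term s q n v c (j + 1) p := by
    rw [e3 r₂, h₂, hZ₂, hI p hp, if_neg (lt_irrefl _)]
    simp only [RatOp.apply, term, prod_range_succ, mul_assoc, form]
  refine Runs.instr ?_ fun p' hp' => ?_
  · simp only [Instr.outSize, hval]
    exact h.ratSize_le (h.fits_term hj hp) (by omega)
  · rw [e3 r₂] at hval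
    simp only [Instr.apply, setMem_mem, e3 r₂, hval]
    by_cases hpp : p' = p
    · subst hpp; simp
    · simp only [arr_inj, hpp, and_true, and_false, if_false, hZ₂, hI p' hp']
      have : p' < p ↔ p' < p + 1 := by omega
      simp only [this]

theorem runs_evaluate (h : Setup s q b N M n v c) (hσ : Ready s q n v c σ) :
    Runs b N (evaluate s q) σ fun τ =>
      (∀ j < s, ∀ k < n j, τ.mem (aX s q j) k = cand s q v c j k) ∧
      τ.mem (aObj s q) 0 = objective s (q + 1) n coeff v (cand s q v c) := by
  have e3 : ∀ {τ}, Ready s q n v c τ → τ.idx (rZ s) = 0 := fun hτ => by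
    rw [hτ.idx _ (by simp), h.zero]
  have tZ : ∀ p, Tame s q (.instr (.ratConst (aZ s q p) (rZ s) (coeff p))) :=
    fun p => tame_ratConst (by simp) (by simp)
  refine Runs.seq (Runs.rep (fun m τ => ∀ p < m, τ.mem (aZ s q p) 0 = term s q n v c 0 p) (by simp)
    fun p hp σ' hI f' => Runs.instr ?_ ?_) fun σ₁ h₁ f₁ => ?_
  · have := h.fits_term (Nat.zero_le s) hp
    simp only [term, range_zero, prod_empty, mul_one] at this
    exact h.ratSize_le this (by omega)
  · have r' := hσ.frame (Tame.rep tZ) f'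
    intro p' hp'
    simp only [Instr.apply, setMem_mem, e3 r', arr_inj, true_and, and_true]
    split_ifs with hpp
    · subst hpp; simp [term]
    · exact hI p' (by omega)
  have r₁ := hσ.frame (Tame.rep tZ) f₁
  have tB : ∀ j, Tame s q (.seq (makeCandidate s q j) (multiply s q j)) :=
    fun j => (tame_makeCandidate j).seq (tame_multiply j)
  refine Runs.seq (Runs.rep (fun m τ =>
      (∀ j < m, ∀ k < n j, τ.mem (aX s q j) k = cand s q v c j k) ∧
      ∀ p < q + 1, τ.mem (aZ s q p) 0 = term s q n v c m p) ⟨by simp, h₁⟩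
    fun j hj σ' hI f' => ?_) fun σ₂ h₂ f₂ => ?_
  · have r' := r₁.frame (Tame.rep tB) f'
    refine Runs.seq (runs_makeCandidate h r' hj) fun σ₃ h₃ f₃ => ?_
    have r₃ := r'.frame (tame_makeCandidate j) f₃
    refine (runs_multiply h r₃ hj h₃ fun p hp => ?_).imp fun τ hτ f₄ => ⟨fun j' hj' k hk => ?_, hτ⟩
    · rw [f₃.mem _ (avoids_makeCandidate (by simp) (by simp) (by simp) (by simp) (by simp)),
        hI.2 p hp]
    · rw [f₄.mem _ (avoids_multiply (by simp) (by simp) (by simp))]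
      rcases Nat.lt_succ_iff_lt_or_eq.1 hj' with hlt | rfl
      · rw [f₃.mem _ (avoids_makeCandidate (by simp) (by simp [hlt.ne]) (by simp) (by simp)
          (by simp)), hI.1 j' hlt k hk]
      · exact h₃ k hk
  have r₂ := r₁.frame (Tame.rep tB) f₂
  refine Runs.seq (Mid := fun τ => τ.mem (aObj s q) 0 = 0)
    (Runs.instr (h.ratSize_le (t := 0) (fits_zero _) (by omega)) ?_) fun σ₃ h₃ f₃ => ?_
  · simp only [Instr.apply, setMem_mem, e3 r₂, and_self, if_true]
  have r₃ := r₂.frame (tame_ratConst (by simp) (by simp)) f₃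
  have tO : ∀ p, Tame s q (.instr
      (.ratArith .add (aObj s q) (rZ s) (aObj s q) (rZ s) (aZ s q p) (rZ s))) :=
    fun p => tame_ratArith (by simp) (by simp)
  refine (Runs.rep (fun m τ => τ.mem (aObj s q) 0 = ∑ p ∈ range m, term s q n v c s p)
    (by simpa using h₃) fun p hp σ' hI f' => ?_).imp fun τ hτ f₄ => ⟨fun j hj k hk => ?_, hτ⟩
  · have r' := r₃.frame (Tame.rep tO) f'
    have hval : RatOp.add.apply (σ'.mem (aObj s q) (σ'.idx (rZ s)))
        (σ'.mem (aZ s q p) (σ'.idx (rZ s))) = ∑ p ∈ range (p + 1), term s q n v c s p := by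
      rw [e3 r', hI, f'.mem _ (avoids_rep.2 fun p _ => by simp [Prog.Avoids, Instr.Avoids]),
        f₃.mem _ (by simp [Prog.Avoids, Instr.Avoids]), h₂.2 p hp, sum_range_succ]
      rfl
    refine Runs.instr ?_ ?_
    · simp only [Instr.outSize, hval]
      exact h.ratSize_le (h.fits_sum_term hp) (by omega)
    · rw [e3 r'] at hval
      simp only [Instr.apply, setMem_mem, e3 r', hval, and_self, if_true]
  · rw [f₄.mem _ (avoids_rep.2 fun p _ => by simp [Prog.Avoids, Instr.Avoids]),
      f₃.mem _ (by simp [Prog.Avoids, Instr.Avoids]), h₂.1 j hj k hk]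

end BoolSearch

namespace BoolSearch

open Finset StrongPoly

/-! ### Exhaustive search -/

section Programs

variable (s q : ℕ)

/-- Preparation of constants and data. -/
def prepare : Prog :=
  .seq (.instr (.idxConst (rO s) 1)) (.seq (.instr (.idxConst (rT s) 3))
    (.seq (.instr (.ratConst (aSgn s q) (rO s) 1)) (.seq (.instr (.idxConst (rK s) 2))
      (.seq (.instr (.ratConst (aSgn s q) (rK s) (-1)))
        (rep (rK s) (fun j => .seq
          (vec s j .add (aW s q j 0 0) (aSgn s q) (rO s) (aSgn s q) (rZ s))
          (rep (rK s) (fun p =>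
            vec s j .add (aW s q j 0 (p + 1)) (p * s + j) (rK s) (aSgn s q) (rZ s)) q)) s)))))

/-- Storage of the candidates and of the value of the objective function. -/
def store : Prog :=
  .seq (.instr (.ratArith .add (aBest s q) (rZ s) (aObj s q) (rZ s) (aSgn s q) (rZ s)))
    (rep (rK s) (fun j => vec s j .add (aBestX s q j) (aX s q j) (rK s) (aSgn s q) (rZ s)) s)

/-- Evaluation of the candidates, and storage if they are better than the stored ones. -/
def improve : Prog :=
  .seq (evaluate s q) (.ite (.ratLt (aObj s q) (rZ s) (aBest s q) (rZ s)) (store s q) (skip (rK s)))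

/-- The counters and their bounds. -/
def counters : List (ℕ × ℕ) :=
  (List.range s).flatMap fun j => (starReg s j, j) ::
    (List.range (q + 1)).flatMap fun i => [(pivotReg s j i, j), (signReg s j i, rT s)]

/-- Search for the best candidates. -/
def search : Prog :=
  .seq (prepare s q) (.seq (evaluate s q) (.seq (store s q)
    (nest (rO s) (counters s q) (improve s q))))

/-- Output of the arrays `src j`, or of the entries `i` of these arrays. -/
def output (src : ℕ → ℕ) (i : ℕ) : Prog :=
  rep (rK s) (fun j => vec s j .add j (src j) i (aSgn s q) (rZ s)) s

/-- Minimization over admissible vectors. -/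
def solveNonzero : Prog := .seq (search s q) (output s q (aBestX s q) (rK s))

/-- Minimization over admissible vectors and zero. -/
def solve : Prog :=
  .seq (search s q) (.ite (.ratLt (aSgn s q) (rZ s) (aBest s q) (rZ s))
    (output s q (fun _ => aSgn s q) (rZ s)) (output s q (aBestX s q) (rK s)))

end Programs

/-- The assumptions on the data. -/
structure Bounds (s q b N M : ℕ) (n : ℕ → ℕ) (v : ℕ → ℕ → ℕ → ℚ) : Prop where
  pos : ∀ j < s, 0 < n j
  le_M : ∀ j < s, n j ≤ M
  le_N : ∀ j < s, n j ≤ N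
  three_le : 3 ≤ N
  fits : ∀ j < s, ∀ p < q + 1, ∀ k < n j, Fits M (v j p k)
  bound : 2 * grow M (3 * q + s + q + 7) + 3 ≤ b

/-- The dimensions and the constants are in the registers. -/
structure Constants (s : ℕ) (n : ℕ → ℕ) (c : ℕ → ℕ) : Prop where
  dim : ∀ j < s, c j = n j
  zero : c (rZ s) = 0
  one : c (rO s) = 1
  three : c (rT s) = 3

variable {s q b N M : ℕ} {n : ℕ → ℕ} {v : ℕ → ℕ → ℕ → ℚ} {c : ℕ → ℕ} {σ τ : State}

theorem mem_counters {x : ℕ × ℕ} : x ∈ counters s q ↔ ∃ j < s, x = (starReg s j, j) ∨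
    ∃ i < q + 1, x = (pivotReg s j i, j) ∨ x = (signReg s j i, rT s) := by
  simp [counters]

theorem nodup_counters : ((counters s q).map Prod.fst).Nodup := by
  simp only [counters, List.map_flatMap, List.map_cons, List.map_nil]
  rw [List.nodup_flatMap]
  refine ⟨fun j _ => List.nodup_cons.2 ⟨by simp, List.nodup_flatMap.2 ⟨fun i _ => by simp, ?_⟩⟩, ?_⟩
  · refine List.nodup_range.imp fun {i i'} hi => ?_
    simp [Function.onFun, List.Disjoint, hi]
  · refine List.nodup_range.imp fun {j j'} hj => ?_
    simp only [Function.onFun, List.Disjoint, List.mem_cons, List.mem_flatMap, List.mem_range,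
      List.not_mem_nil, or_false]
    rintro r (rfl | ⟨i, -, rfl | rfl⟩) (h | ⟨i', -, h | h⟩) <;> simp [hj] at h

/-- The bounds of the counters. -/
def limit (s : ℕ) (n : ℕ → ℕ) (r : ℕ) : ℕ := if r < s then n r else 3

theorem limit_of_lt {j : ℕ} (hj : j < s) : limit s n j = n j := if_pos hj

theorem limit_rT : limit s n (rT s) = 3 := if_neg (by simp [reg])

theorem forall_counters {f : ℕ × ℕ → Prop} : (∀ x ∈ counters s q, f x) ↔
    ∀ j < s, f (starReg s j, j) ∧
      ∀ i < q + 1, f (pivotReg s j i, j) ∧ f (signReg s j i, rT s) := by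
  simp only [mem_counters]
  constructor
  · exact fun h j hj => ⟨h _ ⟨j, hj, .inl rfl⟩, fun i hi =>
      ⟨h _ ⟨j, hj, .inr ⟨i, hi, .inl rfl⟩⟩, h _ ⟨j, hj, .inr ⟨i, hi, .inr rfl⟩⟩⟩⟩
  · rintro h x ⟨j, hj, rfl | ⟨i, hi, rfl | rfl⟩⟩
    · exact (h j hj).1
    · exact ((h j hj).2 i hi).1
    · exact ((h j hj).2 i hi).2

/-! ### Correctness of the exhaustive search -/

theorem Bounds.setup (h : Bounds s q b N M n v) (hc : Constants s n c)
    (hx : ∀ x ∈ counters s q, c x.1 < limit s n x.2) : Setup s q b N M n v c := by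
  rw [forall_counters] at hx
  refine ⟨hc.dim, hc.zero, hc.one, fun j hj i hi => ?_, fun j hj i hi => ?_, fun j hj => ?_,
    h.le_M, h.le_N, h.fits, h.bound⟩
  · simpa only [limit_of_lt hj] using ((hx j hj).2 i hi).1
  · simpa only [limit_rT] using ((hx j hj).2 i hi).2
  · simpa only [limit_of_lt hj] using (hx j hj).1

theorem Bounds.seven_le (h : Bounds s q b N M n v) : 7 ≤ b := by
  have := h.bound
  have := le_grow M (3 * q + s + q + 7)
  omega

theorem Bounds.le_b (h : Bounds s q b N M n v) {j : ℕ} (hj : j < s) : n j ≤ b := by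
  have := h.bound
  have := le_grow M (3 * q + s + q + 7)
  have := h.le_M j hj
  omega

theorem Bounds.ratSize_le (h : Bounds s q b N M n v) {x : ℚ} (hx : Fits M x) : ratSize x ≤ b := by
  have := hx.ratSize_le
  have := h.bound
  have := le_grow M (3 * q + s + q + 7)
  omega

theorem runs_prepare (h : Bounds s q b N M n v) (hdim : ∀ j < s, σ.idx j = n j)
    (hidx : ∀ r, s ≤ r → σ.idx r = 0) (hmem : ∀ a k, (q + 1) * s ≤ a → σ.mem a k = 0)
    (hone : ∀ j k, v j 0 k = 1)
    (hdata : ∀ j < s, ∀ p < q, ∀ k < n j, σ.mem (p * s + j) k = v j (p + 1) k) :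
    Runs b N (prepare s q) σ fun τ =>
      Ready s q n v (fun r => if r = rO s then 1 else if r = rT s then 3 else σ.idx r) τ := by
  set c₀ : ℕ → ℕ := fun r => if r = rO s then 1 else if r = rT s then 3 else σ.idx r with hc₀
  have h7 := h.seven_le
  have hsz : ∀ m ≤ 3, natSize m ≤ b := fun m hm => (natSize_le_self m).trans (by omega)
  have hreg : ∀ k j i, σ.idx (reg s k j i) = 0 := fun k j i => hidx _ (by simp [reg])
  have hS0 : ∀ k, σ.mem (aSgn s q) k = 0 := fun k => hmem _ k (by simp [arr])
  unfold prepare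
  refine Runs.seq (Mid := (· = _)) (Runs.instr (hsz 1 (by norm_num)) rfl) ?_
  rintro _ rfl -
  refine Runs.seq (Mid := (· = _)) (Runs.instr (hsz 3 le_rfl) rfl) ?_
  rintro _ rfl -
  refine Runs.seq (Mid := (· = _)) (Runs.instr (h.ratSize_le (fits_one _)) rfl) ?_
  rintro _ rfl -
  refine Runs.seq (Mid := (· = _)) (Runs.instr (hsz 2 (by norm_num)) rfl) ?_
  rintro _ rfl -
  refine Runs.seq (Mid := fun τ => (∀ r, r ≠ rK s → τ.idx r = c₀ r) ∧
      (∀ i < 3, τ.mem (aSgn s q) i = sgn i) ∧ ∀ a, a ≠ aSgn s q → τ.mem a = σ.mem a)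
    (Runs.instr (h.ratSize_le (fits_one _).neg) ⟨fun r hr => ?_, fun i hi => ?_, fun a ha => ?_⟩)
    fun σ₁ ⟨i₁, s₁, m₁⟩ _ => ?_
  · simp only [Instr.apply, setMem_idx, setIdx_idx, hr, if_false, hc₀]
    by_cases h1 : r = rO s
    · subst h1; simp
    · simp [h1]
  · simp only [Instr.apply, setMem_mem, setMem_idx, setIdx_idx, setIdx_mem, true_and]
    interval_cases i <;> simp [hS0, sgn]
  · simp [Instr.apply, setMem_mem_of_ne _ ha, setIdx_mem]
  have hPk : ∀ j r, r ≠ rK s → (Prog.seq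
      (vec s j .add (aW s q j 0 0) (aSgn s q) (rO s) (aSgn s q) (rZ s))
      (rep (rK s) (fun p =>
        vec s j .add (aW s q j 0 (p + 1)) (p * s + j) (rK s) (aSgn s q) (rZ s)) q)).KeepsReg r :=
    fun j r hr => ⟨keepsReg_vec.2 hr, keepsReg_rep.2 ⟨hr, fun p _ => keepsReg_vec.2 hr⟩⟩
  have hPa : ∀ j a, (∀ p, a ≠ aW s q j 0 p) → (Prog.seq
      (vec s j .add (aW s q j 0 0) (aSgn s q) (rO s) (aSgn s q) (rZ s))
      (rep (rK s) (fun p =>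
        vec s j .add (aW s q j 0 (p + 1)) (p * s + j) (rK s) (aSgn s q) (rZ s)) q)).Avoids a :=
    fun j a ha => ⟨avoids_vec.2 (ha 0), avoids_rep.2 fun p _ => avoids_vec.2 (ha (p + 1))⟩
  refine (Runs.rep (fun m τ => ∀ j < m, ∀ p < q + 1, ∀ k < n j, τ.mem (aW s q j 0 p) k = v j p k)
    (by simp) fun j hj σ' hI f' => ?_).imp fun τ hτ f => ⟨fun r hr => ?_, fun i hi => ?_, hτ⟩
  · have e1 : ∀ r, r ≠ rK s → σ'.idx r = c₀ r := fun r hr => by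
      rw [f'.idx r (keepsReg_rep.2 ⟨hr, fun j _ => hPk j r hr⟩), i₁ r hr]
    have e2 : ∀ i < 3, σ'.mem (aSgn s q) i = sgn i := fun i hi => by
      rw [f'.mem _ (avoids_rep.2 fun j _ => hPa j _ (by simp)), s₁ i hi]
    have e3 : ∀ p < q, ∀ k < n j, σ'.mem (p * s + j) k = v j (p + 1) k := fun p hp k hk => by
      -- Input arrays lie below all names `arr`, so writing to the working arrays cannot damage
      -- them. The input with number `p` becomes vector `p + 1`, since number 0 is the all-ones
      -- vector.
      have hlt : p * s + j < (q + 1) * s := by nlinarith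
      rw [f'.mem _ (avoids_rep.2 fun j _ => hPa j _ fun p' => by simp only [arr]; omega),
        m₁ _ (by simp only [arr]; omega), hdata j hj p hp k hk]
    have hjK : j ≠ rK s := ne_reg hj
    have cO : c₀ (rO s) = 1 := by simp [hc₀]
    have cZ : c₀ (rZ s) = 0 := by simp [hc₀, hreg]
    have cJ : c₀ j = n j := by simp [hc₀, ne_reg hj, hdim j hj]
    refine Runs.seq (runs_vec (fun _ => 1) (h.le_N j hj) (h.le_b hj) (by rw [e1 _ (by simp), cO])
      (by rw [e1 _ hjK, cJ]) hjK (by simp) (by simp) (fun k _ => ?_)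
      fun k _ => h.ratSize_le (fits_one _)) fun σ₂ h₂ f₂ => ?_
    · simp only [RatOp.apply, reg_inj, one_ne_zero, OfNat.ofNat_ne_zero, false_and, if_false]
      rw [e1 _ (by simp), e1 _ (by simp), cO, cZ, e2 1 (by norm_num), e2 0 (by norm_num)]
      simp [sgn]
    have hQk : ∀ r, r ≠ rK s → (rep (rK s) (fun p =>
        vec s j .add (aW s q j 0 (p + 1)) (p * s + j) (rK s) (aSgn s q) (rZ s)) q).KeepsReg r :=
      fun r hr => keepsReg_rep.2 ⟨hr, fun p _ => keepsReg_vec.2 hr⟩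
    refine (Runs.rep (fun m τ => ∀ p < m, ∀ k < n j, τ.mem (aW s q j 0 (p + 1)) k = v j (p + 1) k)
      (by simp) fun p hp σ₃ hI₃ f₃ => ?_).imp fun τ hτ f₄ => ?_
    · have g1 : ∀ r, r ≠ rK s → σ₃.idx r = c₀ r := fun r hr => by
        rw [f₃.idx r (hQk r hr), f₂.idx r (keepsReg_vec.2 hr), e1 r hr]
      have g2 : σ₃.mem (aSgn s q) 0 = 0 := by
        rw [f₃.mem _ (avoids_rep.2 fun p _ => avoids_vec.2 (by simp)),
          f₂.mem _ (avoids_vec.2 (by simp)), e2 0 (by norm_num), sgn_zero]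
      have hlt : p * s + j < (q + 1) * s := by nlinarith
      have g3 : ∀ k < n j, σ₃.mem (p * s + j) k = v j (p + 1) k := fun k hk => by
        rw [f₃.mem _ (avoids_rep.2 fun p _ => avoids_vec.2 (by simp only [arr]; omega)),
          f₂.mem _ (avoids_vec.2 (by simp only [arr]; omega)), e3 p hp k hk]
      refine (runs_vec (fun k => v j (p + 1) k) (h.le_N j hj) (h.le_b hj)
        (by rw [g1 _ (by simp), cO]) (by rw [g1 _ hjK, cJ]) hjK (by simp only [arr]; omega) (by simp)
        (fun k hk => ?_) fun k hk => h.ratSize_le (h.fits j hj _ (by omega) k hk)).imp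
        fun τ hτ f₅ p' hp' k hk => ?_
      · simp only [if_true, RatOp.apply, reg_inj, one_ne_zero, false_and, if_false]
        rw [g1 _ (by simp), cZ, g2, g3 k hk, add_zero]
      · rcases Nat.lt_succ_iff_lt_or_eq.1 hp' with hlt | rfl
        · rw [f₅.mem _ (avoids_vec.2 (by simp [hlt.ne])), hI₃ p' hlt k hk]
        · exact hτ k hk
    · intro j' hj' p hp k hk
      rcases Nat.lt_succ_iff_lt_or_eq.1 hj' with hlt | rfl
      · rw [f₄.mem _ (avoids_rep.2 fun p _ => avoids_vec.2 (by simp [hlt.ne])),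
          f₂.mem _ (avoids_vec.2 (by simp [hlt.ne])), hI j' hlt p hp k hk]
      · cases p with
        | zero =>
          rw [f₄.mem _ (avoids_rep.2 fun p _ => avoids_vec.2 (by simp)), h₂ k hk, hone]
        | succ p => exact hτ p (by omega) k hk
  · rw [f.idx r (keepsReg_rep.2 ⟨hr, fun j _ => hPk j r hr⟩), i₁ r hr]
  · rw [f.mem _ (avoids_rep.2 fun j _ => hPa j _ (by simp)), s₁ i hi]

theorem tame_store : Tame s q (store s q) :=
  (tame_ratArith (by simp) (by simp)).seq (Tame.rep fun _ => tame_vec (by simp) (by simp))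

theorem tame_improve : Tame s q (improve s q) :=
  tame_evaluate.seq (tame_store.ite
    ⟨fun _ hr => hr, trivial, fun _ _ => trivial⟩)

/-- The stored vectors are admissible, and their value is stored. -/
def Stored (s q : ℕ) (n : ℕ → ℕ) (v : ℕ → ℕ → ℕ → ℚ) (σ : State) : Prop :=
  ∃ x : ℕ → ℕ → ℚ, (∀ j < s, Admissible (n j) (x j)) ∧
    (∀ j < s, ∀ k < n j, σ.mem (aBestX s q j) k = x j k) ∧
    σ.mem (aBest s q) 0 = objective s (q + 1) n coeff v x

theorem runs_store (h : Setup s q b N M n v c) (hσ : Ready s q n v c σ)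
    (hX : ∀ j < s, ∀ k < n j, σ.mem (aX s q j) k = cand s q v c j k)
    (hO : σ.mem (aObj s q) 0 = objective s (q + 1) n coeff v (cand s q v c)) :
    Runs b N (store s q) σ fun τ => Stored s q n v τ ∧
      τ.mem (aBest s q) 0 = objective s (q + 1) n coeff v (cand s q v c) := by
  have e1 : ∀ {τ}, Ready s q n v c τ → τ.idx (rO s) = 1 := fun hτ => by
    rw [hτ.idx _ (by simp), h.one]
  have e3 : ∀ {τ}, Ready s q n v c τ → τ.idx (rZ s) = 0 := fun hτ => by
    rw [hτ.idx _ (by simp), h.zero]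
  have hval : RatOp.add.apply (σ.mem (aObj s q) 0) (σ.mem (aSgn s q) 0) =
      objective s (q + 1) n coeff v (cand s q v c) := by
    rw [hO, hσ.sgn 0 (by norm_num), sgn_zero]
    exact add_zero _
  refine Runs.seq (Mid := fun τ => τ.mem (aBest s q) 0 =
    objective s (q + 1) n coeff v (cand s q v c)) (Runs.instr ?_ ?_) fun σ₁ h₁ f₁ => ?_
  · simp only [Instr.outSize, e3 hσ, hval]
    exact h.ratSize_le (h.fits_sum_term le_rfl) (by omega)
  · simp only [Instr.apply, setMem_mem, e3 hσ, hval, and_self, if_true]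
  have r₁ := hσ.frame (tame_ratArith (by simp) (by simp)) f₁
  refine (Runs.rep (fun m τ => ∀ j < m, ∀ k < n j, τ.mem (aBestX s q j) k = cand s q v c j k)
    (by simp) fun j hj σ' hI f' => ?_).imp fun τ hτ f₂ => ?_
  · have r' := r₁.frame (Tame.rep fun _ => tame_vec (by simp) (by simp)) f'
    refine (runs_vec (fun k => cand s q v c j k) (h.le_N j hj) (h.le_b hj) (e1 r')
      (by rw [r'.idx _ (ne_reg hj), h.dim j hj]) (ne_reg hj) (by simp) (by simp) (fun k hk => ?_)
      fun k _ => h.ratSize_le (t := 0) (fits_cand _ j k) (by omega)).imp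
      fun τ hτ f j' hj' k hk => ?_
    · simp only [if_true, RatOp.apply, reg_inj, one_ne_zero, false_and, if_false]
      rw [f'.mem _ (avoids_rep.2 fun j _ => avoids_vec.2 (by simp)),
        f₁.mem _ (by simp [Prog.Avoids, Instr.Avoids]), hX j hj k hk, e3 r',
        r'.sgn 0 (by norm_num), sgn_zero, add_zero]
    · rcases Nat.lt_succ_iff_lt_or_eq.1 hj' with hlt | rfl
      · rw [f.mem _ (avoids_vec.2 (by simp [hlt.ne])), hI j' hlt k hk]
      · exact hτ k hk
  · have hb : τ.mem (aBest s q) 0 = objective s (q + 1) n coeff v (cand s q v c) := by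
      rw [f₂.mem _ (avoids_rep.2 fun j _ => avoids_vec.2 (by simp)), h₁]
    exact ⟨⟨cand s q v c, fun j hj => candidate_admissible _ _ _ _ (h.star j hj), hτ, hb⟩, hb⟩

theorem avoids_evaluate {a : ℕ} (h : ∀ p, a ≠ aZ s q p) (h1 : a ≠ aR s q) (h2 : ∀ j, a ≠ aX s q j)
    (h3 : a ≠ aQ s q) (h4 : a ≠ aS s q) (h5 : ∀ j i p, a ≠ aW s q j (i + 1) p) (h6 : a ≠ aP s q)
    (h7 : a ≠ aY s q) (h8 : a ≠ aObj s q) : (evaluate s q).Avoids a :=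
  ⟨avoids_rep.2 fun p _ => h p, avoids_rep.2 fun j _ =>
    ⟨avoids_makeCandidate h1 (h2 j) h3 h4 (h5 j), avoids_multiply h6 h7 h⟩, h8,
    avoids_rep.2 fun _ _ => h8⟩

theorem runs_improve (h : Setup s q b N M n v c) (hσ : Ready s q n v c σ)
    (hS : Stored s q n v σ) :
    Runs b N (improve s q) σ fun τ => Stored s q n v τ ∧
      τ.mem (aBest s q) 0 ≤ objective s (q + 1) n coeff v (cand s q v c) ∧
      τ.mem (aBest s q) 0 ≤ σ.mem (aBest s q) 0 := by
  refine Runs.seq (runs_evaluate h hσ) fun σ₁ h₁ f₁ => ?_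
  have r₁ := hσ.frame tame_evaluate f₁
  have e3 : σ₁.idx (rZ s) = 0 := by rw [r₁.idx _ (by simp), h.zero]
  have eB : σ₁.mem (aBest s q) = σ.mem (aBest s q) := f₁.mem _ (avoids_evaluate (by simp) (by simp)
    (by simp) (by simp) (by simp) (by simp) (by simp) (by simp) (by simp))
  refine Runs.ite (fun hc => ?_) fun hc => Runs.skip ?_
  · simp only [Test.Holds, e3, h₁.2, eB] at hc
    refine (runs_store h r₁ h₁.1 h₁.2).imp fun τ hτ _ => ⟨hτ.1, hτ.2.le, ?_⟩
    rw [hτ.2]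
    exact hc.le
  · simp only [Test.Holds, e3, h₁.2, eB, not_lt] at hc
    rw [eB]
    refine ⟨?_, hc, le_rfl⟩
    obtain ⟨x, hx, hxB, hxO⟩ := hS
    refine ⟨x, hx, fun j hj k hk => ?_, by rw [eB, hxO]⟩
    rw [f₁.mem _ (avoids_evaluate (by simp) (by simp) (by simp) (by simp) (by simp) (by simp)
      (by simp) (by simp) (by simp)), hxB j hj k hk]

theorem cand_congr {c c' : ℕ → ℕ} (h : ∀ x ∈ counters s q, c x.1 = c' x.1) {j : ℕ} (hj : j < s) :
    cand s q v c j = cand s q v c' j := by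
  rw [forall_counters] at h
  obtain ⟨h1, h2⟩ := h j hj
  funext k
  simp only [cand, candidate]
  rw [pattern_congr (fun i hi => (h2 i hi).1) fun i hi => (h2 i hi).2, h1]

/-- Registers with prescribed contents of the counters. -/
def register (s : ℕ) (κ σ : ℕ → ℕ → ℕ) (t : ℕ → ℕ) (r : ℕ) : ℕ :=
  let u := (r - s).unpair
  let w := u.2.unpair
  if u.1 = 4 then κ w.1 w.2 else if u.1 = 5 then σ w.1 w.2 else t w.1

theorem runs_search (h : Bounds s q b N M n v) (hdim : ∀ j < s, σ.idx j = n j)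
    (hidx : ∀ r, s ≤ r → σ.idx r = 0) (hmem : ∀ a k, (q + 1) * s ≤ a → σ.mem a k = 0)
    (hone : ∀ j k, v j 0 k = 1)
    (hdata : ∀ j < s, ∀ p < q, ∀ k < n j, σ.mem (p * s + j) k = v j (p + 1) k) :
    Runs b N (search s q) σ fun τ => Constants s n τ.idx ∧ τ.mem (aSgn s q) 0 = 0 ∧
      Stored s q n v τ ∧ ∀ y : ℕ → ℕ → ℚ, (∀ j < s, Admissible (n j) (y j)) →
        τ.mem (aBest s q) 0 ≤ objective s (q + 1) n coeff v y := by
  refine Runs.seq (runs_prepare h hdim hidx hmem hone hdata) fun σ₁ r₁ _ => ?_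
  set c₀ : ℕ → ℕ := fun r => if r = rO s then 1 else if r = rT s then 3 else σ.idx r with hc₀
  have hreg : ∀ k j i, σ.idx (reg s k j i) = 0 := fun k j i => hidx _ (by simp [reg])
  have hconst : Constants s n c₀ := by
    refine ⟨fun j hj => ?_, ?_, ?_, ?_⟩
    · simp [hc₀, ne_reg hj, hdim j hj]
    · simp [hc₀, hreg]
    · simp [hc₀]
    · simp [hc₀]
  -- All counters are 0 initially, and dimensions are positive, so the registers already describe a
  -- candidate. It provides the first stored value.
  have hset : Setup s q b N M n v c₀ := h.setup hconst <| forall_counters.2 fun j hj => by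
    simp [hc₀, hreg, limit_of_lt hj, limit_rT, h.pos j hj]
  refine Runs.seq (runs_evaluate hset r₁) fun σ₂ h₂ f₂ => ?_
  have r₂ := r₁.frame tame_evaluate f₂
  refine Runs.seq (runs_store hset r₂ h₂.1 h₂.2) fun σ₃ h₃ f₃ => ?_
  have r₃ := r₂.frame tame_store f₃
  have hconst' : ∀ {τ}, Ready s q n v c₀ τ → Constants s n τ.idx := fun hτ => by
    refine ⟨fun j hj => ?_, ?_, ?_, ?_⟩
    · rw [hτ.idx _ (ne_reg hj), hconst.dim j hj]
    · rw [hτ.idx _ (by simp), hconst.zero]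
    · rw [hτ.idx _ (by simp), hconst.one]
    · rw [hτ.idx _ (by simp), hconst.three]
  have hself : ∀ {c τ}, Ready s q n v c τ → Ready s q n v τ.idx τ := fun hτ =>
    ⟨fun _ _ => rfl, hτ.sgn, hτ.data⟩
  -- The invariant refers to the current registers because the counters move. The property `G`
  -- persists since the stored value never increases, and it depends on the counters only, which is
  -- expressed by `D`.
  refine (Runs.nest (I := fun τ => Constants s n τ.idx ∧ Ready s q n v τ.idx τ ∧ Stored s q n v τ)
    (G := fun c τ => τ.mem (aBest s q) 0 ≤ objective s (q + 1) n coeff v (cand s q v c))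
    (D := fun r => ∃ x ∈ counters s q, r = x.1) (β := limit s n) ?_ ?_ nodup_counters ?_ ?_ ?_ ?_
    ?_ ?_ ?_ ?_ ?_ ?_ ⟨hconst' r₃, hself r₃, h₃.1⟩).imp ?_
  · exact forall_counters.2 fun j hj => by
      simp [limit_of_lt hj, limit_rT, h.le_N j hj, h.three_le]
  · have := h.seven_le
    exact forall_counters.2 fun j hj => by
      simp only [limit_of_lt hj, limit_rT, h.le_b hj, true_and]
      exact fun _ _ => by omega
  · refine forall_counters.2 fun j hj => ?_
    simp only [forall_counters, ne_eq, reg_inj, false_and, not_false_eq_true, and_true,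
      Nat.reduceEqDiff]
    exact ⟨fun j' hj' => ⟨ne_reg hj', fun _ _ => ne_reg hj'⟩,
      fun i hi => ⟨fun j' hj' => ⟨ne_reg hj', fun _ _ => ne_reg hj'⟩,
        fun j' hj' => ⟨ne_reg hj', fun _ _ => ne_reg hj'⟩⟩⟩
  · exact forall_counters.2 fun j hj => by simp
  · exact forall_counters.2 fun j hj =>
      ⟨⟨tame_improve.1 _ (by simp), tame_improve.1 _ (ne_reg hj)⟩, fun i hi =>
        ⟨⟨tame_improve.1 _ (by simp), tame_improve.1 _ (ne_reg hj)⟩,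
          ⟨tame_improve.1 _ (by simp), tame_improve.1 _ (by simp)⟩⟩⟩
  · exact tame_improve.1 _ (by simp)
  · rintro r ⟨x, hx, rfl⟩
    exact (forall_counters (f := fun x => (improve s q).KeepsReg x.1)).2 (fun j hj =>
      ⟨tame_improve.1 _ (by simp), fun i hi =>
        ⟨tame_improve.1 _ (by simp), tame_improve.1 _ (by simp)⟩⟩) x hx
  · rintro τ x hx w ⟨hC, hR, hS⟩
    refine ⟨?_, ⟨fun _ _ => rfl, hR.sgn, hR.data⟩, hS⟩
    have hne := (forall_counters (s := s) (q := q) (f := fun x => (∀ j < s, j ≠ x.1) ∧ rZ s ≠ x.1 ∧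
      rO s ≠ x.1 ∧ rT s ≠ x.1)).2 (fun j hj => ⟨⟨fun j' hj' => ne_reg hj', by simp⟩, fun i hi =>
        ⟨⟨fun j' hj' => ne_reg hj', by simp⟩, ⟨fun j' hj' => ne_reg hj', by simp⟩⟩⟩) x hx
    refine ⟨fun j hj => ?_, ?_, ?_, ?_⟩
    · rw [setIdx_idx, if_neg (hne.1 j hj), hC.dim j hj]
    · rw [setIdx_idx, if_neg hne.2.1, hC.zero]
    · rw [setIdx_idx, if_neg hne.2.2.1, hC.one]
    · rw [setIdx_idx, if_neg hne.2.2.2, hC.three]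
  · exact fun c τ x hx w hG => hG
  · rintro τ ⟨hC, -, -⟩
    refine ⟨hC.one, forall_counters.2 fun j hj => ?_⟩
    simp [limit_of_lt hj, limit_rT, hC.dim j hj, hC.three]
  · intro c c' τ hcc hG
    refine hG.trans (objective_congr fun j hj k _ => ?_).le
    rw [cand_congr (fun x hx => hcc x.1 ⟨x, hx, rfl⟩) hj]
  · rintro τ ⟨hC, hR, hS⟩ hx
    refine (runs_improve (h.setup hC hx) hR hS).imp fun υ hυ f => ?_
    have hR' := hR.frame tame_improve f
    refine ⟨⟨?_, hself hR', hυ.1⟩, hυ.2.1, fun c hc => hυ.2.2.trans hc⟩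
    refine ⟨fun j hj => ?_, ?_, ?_, ?_⟩
    · rw [hR'.idx _ (ne_reg hj), hC.dim j hj]
    · rw [hR'.idx _ (by simp), hC.zero]
    · rw [hR'.idx _ (by simp), hC.one]
    · rw [hR'.idx _ (by simp), hC.three]
  · rintro τ ⟨⟨hC, hR, hS⟩, -, hall⟩ -
    refine ⟨hC, by rw [hR.sgn 0 (by norm_num), sgn_zero], hS, fun y hy => ?_⟩
    -- Any admissible competitor is dominated by candidates, whose pivots, signs and special entries
    -- are among the values the counters have taken.
    obtain ⟨κ, σ', t, hv, hle⟩ := exists_candidates_le (d := q + 1) (γ := coeff) (v := v) hy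
    refine (hall (register s κ σ' t) ?_ (forall_counters.2 fun j hj => ?_)).trans
      (le_of_eq_of_le ?_ hle)
    · rintro r ⟨x, hx, rfl⟩ hr
      exact absurd rfl (hr x hx)
    · have := hv j hj
      simp only [limit_of_lt hj, limit_rT]
      simp only [register, reg, Nat.add_sub_cancel_left, Nat.unpair_pair,
        Nat.reduceEqDiff, if_true, if_false]
      exact ⟨this.2, this.1⟩
    · refine objective_congr fun j hj k _ => ?_
      simp [cand, register, reg]

/-- The output arrays are below all sources, so no source is overwritten. The choice `i = rK` copies
arrays, while `i = rZ` with the source `aSgn` writes zeros. -/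
theorem runs_output {src : ℕ → ℕ} {i : ℕ} {x : ℕ → ℕ → ℚ} (h : Bounds s q b N M n v)
    (hC : Constants s n σ.idx) (h0 : σ.mem (aSgn s q) 0 = 0) (hsrc : ∀ j, (q + 1) * s ≤ src j)
    (hx : ∀ j < s, ∀ k < n j, σ.mem (src j) (if i = rK s then k else σ.idx i) = x j k)
    (hx' : ∀ j < s, ∀ k < n j, x j k = 0 ∨ x j k = 1) :
    Runs b N (output s q src i) σ fun τ => ∀ j < s, ∀ k < n j, τ.mem j k = x j k := by
  have hs : s ≤ (q + 1) * s := by nlinarith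
  have hA : ∀ a, s ≤ a → (output s q src i).Avoids a := fun a ha =>
    avoids_rep.2 fun j hj => avoids_vec.2 (by omega)
  have hK : ∀ r, r ≠ rK s → (output s q src i).KeepsReg r := fun r hr =>
    keepsReg_rep.2 ⟨hr, fun j _ => keepsReg_vec.2 hr⟩
  have hS : s ≤ aSgn s q := by simp only [arr]; omega
  refine Runs.rep (fun m τ => ∀ j < m, ∀ k < n j, τ.mem j k = x j k) (by simp)
    fun j hj σ' hI f => ?_
  have e : ∀ k < n j, σ'.mem (src j) (if i = rK s then k else σ'.idx i) = x j k := fun k hk => by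
    rw [f.mem _ (hA _ (hs.trans (hsrc j))), ← hx j hj k hk]
    split_ifs with hi
    · rfl
    · rw [f.idx _ (hK i hi)]
  refine (runs_vec (fun k => x j k) (h.le_N j hj) (h.le_b hj)
    (by rw [f.idx _ (hK _ (by simp)), hC.one])
    (by rw [f.idx _ (hK _ (ne_reg hj)), hC.dim j hj]) (ne_reg hj)
    (by have := hsrc j; omega) (by omega) (fun k hk => ?_) fun k hk => ?_).imp
    fun τ hτ f' j' hj' k hk => ?_
  · simp only [RatOp.apply]
    rw [e k hk, if_neg (by simp), f.idx _ (hK _ (by simp)), hC.zero, f.mem _ (hA _ hS), h0, add_zero]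
  · rcases hx' j hj k hk with h' | h' <;> rw [h']
    · exact h.ratSize_le (fits_zero _)
    · exact h.ratSize_le (fits_one _)
  · rcases Nat.lt_succ_iff_lt_or_eq.1 hj' with hlt | rfl
    · rw [f'.mem _ (avoids_vec.2 hlt.ne), hI j' hlt k hk]
    · exact hτ k hk

theorem runs_solveNonzero (h : Bounds s q b N M n v) (hdim : ∀ j < s, σ.idx j = n j)
    (hidx : ∀ r, s ≤ r → σ.idx r = 0) (hmem : ∀ a k, (q + 1) * s ≤ a → σ.mem a k = 0)
    (hone : ∀ j k, v j 0 k = 1)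
    (hdata : ∀ j < s, ∀ p < q, ∀ k < n j, σ.mem (p * s + j) k = v j (p + 1) k) :
    Runs b N (solveNonzero s q) σ fun τ => ∃ x : ℕ → ℕ → ℚ,
      (∀ j < s, Admissible (n j) (x j)) ∧ (∀ j < s, ∀ k < n j, τ.mem j k = x j k) ∧
      ∀ y : ℕ → ℕ → ℚ, (∀ j < s, Admissible (n j) (y j)) →
        objective s (q + 1) n coeff v x ≤ objective s (q + 1) n coeff v y := by
  refine Runs.seq (runs_search h hdim hidx hmem hone hdata) fun τ ⟨hC, h0, ⟨x, hx, hX, hB⟩, hy⟩ _ => ?_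
  refine (runs_output h hC h0 (fun j => by simp only [arr]; omega)
    (fun j hj k hk => by rw [if_pos rfl]; exact hX j hj k hk) fun j hj => (hx j hj).1).imp
    fun υ hυ _ => ⟨x, hx, hυ, fun y hy' => ?_⟩
  rw [← hB]
  exact hy y hy'

/-- Every product has a vanishing factor; for `s = 0` the products would be empty and equal to 1. -/
theorem objective_zero (hs : 0 < s) : objective s (q + 1) n coeff v 0 = 0 := by
  refine sum_eq_zero fun p _ => ?_
  rw [prod_eq_zero (mem_range.2 hs) (by simp), mul_zero]

theorem runs_solve (hs : 0 < s) (h : Bounds s q b N M n v) (hdim : ∀ j < s, σ.idx j = n j)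
    (hidx : ∀ r, s ≤ r → σ.idx r = 0) (hmem : ∀ a k, (q + 1) * s ≤ a → σ.mem a k = 0)
    (hone : ∀ j k, v j 0 k = 1)
    (hdata : ∀ j < s, ∀ p < q, ∀ k < n j, σ.mem (p * s + j) k = v j (p + 1) k) :
    Runs b N (solve s q) σ fun τ => ∃ x : ℕ → ℕ → ℚ,
      ((∀ j < s, Admissible (n j) (x j)) ∧ objective s (q + 1) n coeff v x ≤ 0 ∨ x = 0) ∧
      (∀ j < s, ∀ k < n j, τ.mem j k = x j k) ∧
      ∀ y : ℕ → ℕ → ℚ, (∀ j < s, Admissible (n j) (y j)) →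
        objective s (q + 1) n coeff v x ≤ objective s (q + 1) n coeff v y := by
  refine Runs.seq (runs_search h hdim hidx hmem hone hdata) fun τ ⟨hC, h0, ⟨x, hx, hX, hB⟩, hy⟩ _ => ?_
  refine Runs.ite (fun hc => ?_) fun hc => ?_
  · simp only [Test.Holds, hC.zero, h0] at hc
    refine (runs_output (x := 0) h hC h0 (fun j => by simp only [arr]; omega)
      (fun j hj k hk => by rw [if_neg (by simp), hC.zero, h0]; rfl) fun _ _ _ _ => .inl rfl).imp
      fun υ hυ _ => ⟨0, .inr rfl, hυ, fun y hy' => ?_⟩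
    rw [objective_zero hs]
    exact hc.le.trans (hy y hy')
  · simp only [Test.Holds, hC.zero, h0, not_lt, hB] at hc
    refine (runs_output h hC h0 (fun j => by simp only [arr]; omega)
      (fun j hj k hk => by rw [if_pos rfl]; exact hX j hj k hk) fun j hj => (hx j hj).1).imp
      fun υ hυ _ => ⟨x, .inl ⟨hx, hc⟩, hυ, fun y hy' => ?_⟩
    rw [← hB]
    exact hy y hy'

end BoolSearch

/-! ### The input -/

namespace StrongPoly

theorem Input.idx_le_count (x : Input) (j : ℕ) : x.start.idx j ≤ x.count := by
  rcases lt_or_ge j x.dims.length with h | h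
  · have : x.dims[j] + 1 ≤ (x.dims.map fun n => n + 1).sum :=
      List.single_le_sum (fun _ _ => Nat.zero_le _) _ (List.mem_map.2 ⟨_, List.getElem_mem h, rfl⟩)
    simp only [Input.start, List.getD_eq_getElem _ _ h, Input.count]
    omega
  · simp only [Input.start, List.getD_eq_default _ _ h, Nat.zero_le]

theorem Input.idx_le_size (x : Input) (j : ℕ) : x.start.idx j ≤ x.size := by
  rcases lt_or_ge j x.dims.length with h | h
  · have : x.dims[j] + 1 ≤ (x.dims.map fun n => n + 1).sum :=
      List.single_le_sum (fun _ _ => Nat.zero_le _) _ (List.mem_map.2 ⟨_, List.getElem_mem h, rfl⟩)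
    simp only [Input.start, List.getD_eq_getElem _ _ h, Input.size]
    omega
  · simp only [Input.start, List.getD_eq_default _ _ h, Nat.zero_le]

theorem Input.fits_mem (x : Input) (a k : ℕ) : Fits x.size (x.start.mem a k) := by
  rcases lt_or_ge a x.vecs.length with h | h
  · simp only [Input.start, List.getD_eq_getElem _ _ h]
    rcases lt_or_ge k x.vecs[a].length with h' | h'
    · rw [List.getD_eq_getElem _ _ h']
      refine (fits_ratSize _).mono ?_
      have h1 : ratSize x.vecs[a][k] ≤ (x.vecs[a].map ratSize).sum :=
        List.single_le_sum (fun _ _ => Nat.zero_le _) _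
          (List.mem_map.2 ⟨_, List.getElem_mem h', rfl⟩)
      have h2 : (x.vecs[a].map ratSize).sum ≤ (x.vecs.map fun v => (v.map ratSize).sum).sum :=
        List.single_le_sum (fun _ _ => Nat.zero_le _) _
          (List.mem_map.2 ⟨_, List.getElem_mem h, rfl⟩)
      simp only [Input.size]
      omega
    · rw [List.getD_eq_default _ _ h']
      exact fits_zero _
  · simp only [Input.start, List.getD_eq_default _ _ h, List.getD_nil]
    exact fits_zero _

end StrongPoly

namespace BoolTensor

open Finset StrongPoly BoolSearch

variable {s : ℕ} {n : Fin s → ℕ}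

/-! ### Tensors of Boolean rank at most one -/

theorem outer_binary {c : ∀ j, Fin (n j) → ℚ} (hc : IsBinary c) (k : ∀ j, Fin (n j)) :
    outer c k = 0 ∨ outer c k = 1 := by
  by_cases h : ∃ j, c j (k j) = 0
  · obtain ⟨j, hj⟩ := h
    exact .inl (prod_eq_zero (mem_univ j) hj)
  · push Not at h
    exact .inr (prod_eq_one fun j _ => (hc j (k j)).resolve_left (h j))

theorem disj_outer (c : Fin 1 → ∀ j, Fin (n j) → ℚ) (hc : IsBinary (c 0)) :
    (disj fun i => outer (c i)) = outer (c 0) := by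
  funext k
  rcases outer_binary hc k with h | h <;> simp [disj, h]

theorem hasBooleanFactorization_zero {B : Tensor n} : HasBooleanFactorization B 0 ↔ B = 0 := by
  constructor
  · rintro ⟨c, -, rfl⟩
    funext k
    simp [disj]
  · rintro rfl
    exact ⟨fun i => i.elim0, fun i => i.elim0, by funext k; simp [disj]⟩

theorem hasBooleanFactorization_one {B : Tensor n} :
    HasBooleanFactorization B 1 ↔ ∃ c : ∀ j, Fin (n j) → ℚ, IsBinary c ∧ B = outer c := by
  constructor
  · rintro ⟨c, hc, rfl⟩
    exact ⟨c 0, hc 0, disj_outer c (hc 0)⟩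
  · rintro ⟨c, hc, rfl⟩
    exact ⟨fun _ => c, fun _ => hc, (disj_outer (fun _ => c) hc).symm⟩

/-- Boolean rank 0 means zero, and an outer product of binary vectors vanishes exactly when one of
them does. This is the origin of `Admissible`. -/
theorem hasBooleanRank_one {B : Tensor n} : HasBooleanRank B 1 ↔
    ∃ c : ∀ j, Fin (n j) → ℚ, (IsBinary c ∧ ∀ j, ∃ k, c j k = 1) ∧ B = outer c := by
  constructor
  · rintro ⟨h1, h2⟩
    obtain ⟨c, hc, rfl⟩ := hasBooleanFactorization_one.1 h1
    refine ⟨c, ⟨hc, ?_⟩, rfl⟩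
    by_contra! hj
    obtain ⟨j, hj⟩ := hj
    have h0 : outer c = 0 := by
      funext k
      exact prod_eq_zero (mem_univ j) ((hc j (k j)).resolve_right (hj _))
    exact absurd (h2 (hasBooleanFactorization_zero.2 h0)) (by norm_num)
  · rintro ⟨c, ⟨hc, hone⟩, rfl⟩
    refine ⟨hasBooleanFactorization_one.2 ⟨c, hc, rfl⟩, fun r hr => ?_⟩
    rcases Nat.eq_zero_or_pos r with rfl | h
    · have h0 := hasBooleanFactorization_zero.1 hr
      choose k hk using hone
      have := congrFun h0 k
      simp [outer, hk] at this
    · exact h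

/-- The zero tensor is an outer product of zero vectors provided that there is at least one factor.
-/
theorem hasBooleanRankAtMost_one (hs : 0 < s) {B : Tensor n} : HasBooleanRankAtMost B 1 ↔
    ∃ c : ∀ j, Fin (n j) → ℚ, IsBinary c ∧ B = outer c := by
  constructor
  · rintro ⟨r, hr, h⟩
    rcases Nat.le_one_iff_eq_zero_or_eq_one.1 hr with rfl | rfl
    · refine ⟨0, fun _ _ => .inl rfl, (hasBooleanFactorization_zero.1 h.1).trans ?_⟩
      funext k
      exact (prod_eq_zero (mem_univ ⟨0, hs⟩) rfl).symm
    · exact hasBooleanFactorization_one.1 h.1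
  · rintro ⟨c, hc, rfl⟩
    by_cases h : ∀ j, ∃ k, c j k = 1
    · exact ⟨1, le_rfl, hasBooleanRank_one.2 ⟨c, ⟨hc, h⟩, rfl⟩⟩
    · push Not at h
      obtain ⟨j, hj⟩ := h
      refine ⟨0, by norm_num, hasBooleanFactorization_zero.2 ?_, fun _ _ => Nat.zero_le _⟩
      funext k
      exact prod_eq_zero (mem_univ j) ((hc j (k j)).resolve_right (hj _))

/-! ### The error as an objective function -/

namespace Factorized

variable {q : ℕ} (F : Factorized s q)

/-- The dimensions, as contents of registers. -/
def dim : ℕ → ℕ := F.input.start.idx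

/-- The linear forms; the first one is the sum of the entries. -/
def forms (j p k : ℕ) : ℚ := if p = 0 then 1 else F.input.start.mem ((p - 1) * s + j) k

theorem dim_eq (j : Fin s) : F.dim j = F.n j := by
  simp [dim, input, Input.start]

theorem start_idx_of_le {r : ℕ} (hr : s ≤ r) : F.input.start.idx r = 0 := by
  simp [input, Input.start, hr.not_gt]

theorem start_mem_of_le {a : ℕ} (k : ℕ) (ha : (q + 1) * s ≤ a) : F.input.start.mem a k = 0 := by
  have : q * s ≤ a := by nlinarith
  simp [input, Input.start, this.not_gt]

theorem start_mem (p : Fin q) (j : Fin s) (k : Fin (F.n j)) :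
    F.input.start.mem (p * s + j) k = F.a p j k := by
  have hlt : (p : ℕ) * s + j < q * s := by nlinarith [p.2, j.2]
  have h1 : (⟨p * s + j, hlt⟩ : Fin (q * s)).divNat = p := by
    ext
    simp [Fin.divNat, Nat.add_div_of_dvd_right, Nat.div_eq_of_lt j.2, j.pos]
  have h2 : (⟨p * s + j, hlt⟩ : Fin (q * s)).modNat = j := by
    ext
    simp [Fin.modNat, Nat.mod_eq_of_lt j.2]
  -- The type of `F.a p j` depends on `j`, so the indices are generalized to variables and then
  -- substituted instead of being rewritten.
  have key : ∀ p' j', p' = p → j' = j → (List.ofFn (F.a p' j')).getD k 0 = F.a p j k := by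
    rintro _ _ rfl rfl
    simp
  have hv : F.input.vecs.getD (p * s + j) [] =
      List.ofFn (F.a (Fin.divNat ⟨p * s + j, hlt⟩) (Fin.modNat ⟨p * s + j, hlt⟩)) := by
    simp [input, hlt]
  simp only [Input.start, hv]
  exact key _ _ h1 h2

/-- In the expanded square, `B² = B` makes the quadratic term linear, and the sum of the entries of
an outer product is the product of the entry sums. This yields the coefficients 1 and -2 in `coeff`.
-/
theorem sqError_eq {x : ℕ → ℕ → ℚ} (hx : IsBinary (F.readOff x)) :
    sqError F.tensor (outer (F.readOff x)) =
      ∑ k, F.tensor k ^ 2 + objective s (q + 1) F.dim coeff F.forms x := by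
  have e1 : ∀ k, (F.tensor k - outer (F.readOff x) k) ^ 2 =
      F.tensor k ^ 2 + (outer (F.readOff x) k +
        ∑ p, -2 * (outer (F.a p) k * outer (F.readOff x) k)) := fun k => by
    have hB : outer (F.readOff x) k ^ 2 = outer (F.readOff x) k := by
      rcases outer_binary hx k with h | h <;> rw [h] <;> norm_num
    rw [sub_sq, hB, ← mul_sum, ← sum_mul]
    simp only [tensor, Finset.sum_apply]
    ring
  simp only [sqError, e1, sum_add_distrib]
  congr 1
  have e2 : ∀ c : ∀ j, Fin (F.n j) → ℚ, ∑ k : ∀ j, Fin (F.n j), ∏ j, c j (k j) = ∏ j, ∑ k, c j k := fun c => by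
    rw [prod_univ_sum, Fintype.piFinset_univ]
  unfold objective
  rw [sum_range_succ', add_comm, sum_comm]
  congr 1
  · rw [sum_range]
    refine sum_congr rfl fun p _ => ?_
    rw [← mul_sum]
    congr 1
    simp only [outer, ← prod_mul_distrib]
    rw [e2 fun j k => F.a p j k * F.readOff x j k, prod_range]
    refine prod_congr rfl fun j _ => ?_
    rw [F.dim_eq, sum_range]
    refine sum_congr rfl fun k _ => ?_
    simp [forms, start_mem, readOff]
  · simp only [outer, coeff, if_true, one_mul]
    rw [e2, prod_range]
    refine prod_congr rfl fun j _ => ?_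
    rw [F.dim_eq, sum_range]
    simp [forms, readOff]

/-- Vectors as contents of arrays. -/
def extend (c : ∀ j, Fin (F.n j) → ℚ) (j k : ℕ) : ℚ :=
  if h : ∃ h : j < s, k < F.n ⟨j, h⟩ then c ⟨j, h.1⟩ ⟨k, h.2⟩ else 0

theorem readOff_extend (c : ∀ j, Fin (F.n j) → ℚ) : F.readOff (F.extend c) = c := by
  funext j k
  simp [readOff, extend]

theorem admissible_iff {x : ℕ → ℕ → ℚ} : (∀ j < s, Admissible (F.dim j) (x j)) ↔
    IsBinary (F.readOff x) ∧ ∀ j, ∃ k, F.readOff x j k = 1 := by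
  constructor
  · intro h
    refine ⟨fun j k => (h j j.2).1 k (by rw [F.dim_eq]; exact k.2), fun j => ?_⟩
    obtain ⟨k, hk, hxk⟩ := (h j j.2).2
    exact ⟨⟨k, by rw [← F.dim_eq]; exact hk⟩, hxk⟩
  · rintro ⟨h1, h2⟩ j hj
    have hd : F.dim j = F.n ⟨j, hj⟩ := F.dim_eq ⟨j, hj⟩
    refine ⟨fun k hk => h1 ⟨j, hj⟩ ⟨k, hd ▸ hk⟩, ?_⟩
    obtain ⟨k, hk⟩ := h2 ⟨j, hj⟩
    exact ⟨k, by rw [hd]; exact k.2, hk⟩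

theorem readOff_eq {m x : ℕ → ℕ → ℚ} (h : ∀ j < s, ∀ k < F.dim j, m j k = x j k) :
    F.readOff m = F.readOff x := by
  funext j k
  exact h j j.2 k (by rw [F.dim_eq]; exact k.2)

theorem solved_of_objective_le {m x : ℕ → ℕ → ℚ} (hx : ∀ j < s, Admissible (F.dim j) (x j))
    (hm : ∀ j < s, ∀ k < F.dim j, m j k = x j k)
    (hy : ∀ y : ℕ → ℕ → ℚ, (∀ j < s, Admissible (F.dim j) (y j)) →
      objective s (q + 1) F.dim coeff F.forms x ≤ objective s (q + 1) F.dim coeff F.forms y) :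
    F.Solved m := by
  have hx' := F.admissible_iff.1 hx
  unfold Solved
  rw [F.readOff_eq hm]
  refine ⟨hx'.1, hasBooleanRank_one.2 ⟨_, hx', rfl⟩, fun B' hB' => ?_⟩
  obtain ⟨c, hc, rfl⟩ := hasBooleanRank_one.1 hB'
  rw [← F.readOff_extend c] at hc ⊢
  rw [F.sqError_eq hx'.1, F.sqError_eq hc.1]
  gcongr
  exact hy _ (F.admissible_iff.2 hc)

theorem solvedAtMost_of_objective_le (hs : 0 < s) {m x : ℕ → ℕ → ℚ}
    (hx : (∀ j < s, Admissible (F.dim j) (x j)) ∧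
      objective s (q + 1) F.dim coeff F.forms x ≤ 0 ∨ x = 0)
    (hm : ∀ j < s, ∀ k < F.dim j, m j k = x j k)
    (hy : ∀ y : ℕ → ℕ → ℚ, (∀ j < s, Admissible (F.dim j) (y j)) →
      objective s (q + 1) F.dim coeff F.forms x ≤ objective s (q + 1) F.dim coeff F.forms y) :
    F.SolvedAtMost m := by
  have hb : IsBinary (F.readOff x) := by
    rcases hx with hx | rfl
    · exact (F.admissible_iff.1 hx.1).1
    · exact fun _ _ => .inl rfl
  have h0 : objective s (q + 1) F.dim coeff F.forms x ≤ 0 := by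
    rcases hx with hx | rfl
    · exact hx.2
    · exact (objective_zero hs).le
  unfold SolvedAtMost
  rw [F.readOff_eq hm]
  refine ⟨hb, (hasBooleanRankAtMost_one hs).2 ⟨_, hb, rfl⟩, fun B' hB' => ?_⟩
  obtain ⟨c, hc, rfl⟩ := (hasBooleanRankAtMost_one hs).1 hB'
  by_cases hone : ∀ j, ∃ k, c j k = 1
  · rw [← F.readOff_extend c] at hc hone ⊢
    rw [F.sqError_eq hb, F.sqError_eq hc]
    gcongr
    exact hy _ (F.admissible_iff.2 ⟨hc, hone⟩)
  -- A competitor with a zero factor is the zero tensor. Its objective is 0, and that of `x` is at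
  -- most 0.
  · push Not at hone
    obtain ⟨j, hj⟩ := hone
    have hz : outer c = outer (F.readOff 0) := by
      funext k
      exact (prod_eq_zero (mem_univ j) ((hc j (k j)).resolve_right (hj _))).trans
        (prod_eq_zero (mem_univ j) rfl).symm
    rw [hz, F.sqError_eq hb, F.sqError_eq (fun _ _ => .inl rfl), objective_zero hs]
    gcongr

end Factorized

/-! ### Strongly polynomial time -/

/-- The bound `grow` as a polynomial. -/
noncomputable def growPoly : ℕ → Polynomial ℕ
  | 0 => (4 * Polynomial.X + 1) + (4 * Polynomial.X + 1) +
      (4 * Polynomial.X + 1) * (4 * Polynomial.X + 1)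
  | t + 1 => 4 * growPoly t + 1

theorem eval_growPoly (t M : ℕ) : (growPoly t).eval M = grow M t := by
  induction t with
  | zero => simp [growPoly, grow]
  | succ t ih => simp [growPoly, grow_succ, ih]

/-- Rounds of loops are bounded by the number of data, with 3 added for the sign counters, whereas
lengths are bounded by the encoding length of the input. -/
theorem Factorized.bounds {q : ℕ} (F : Factorized s q) :
    Bounds s q ((2 * growPoly (3 * q + s + q + 7) + 3).eval F.input.size) (F.input.count + 3)
      F.input.size F.dim F.forms where
  pos j hj := by rw [F.dim_eq ⟨j, hj⟩]; exact F.n_pos _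
  le_M j _ := F.input.idx_le_size j
  le_N j _ := (F.input.idx_le_count j).trans (Nat.le_add_right _ _)
  three_le := Nat.le_add_left _ _
  fits j _ p _ k _ := by
    unfold Factorized.forms
    split_ifs
    · exact fits_one _
    · exact F.input.fits_mem _ _
  bound := by simp [eval_growPoly]

theorem solvable_of_runs {s q : ℕ} {Correct : Factorized s q → (ℕ → ℕ → ℚ) → Prop} (P : Prog)
    (h : ∀ F : Factorized s q, Runs ((2 * growPoly (3 * q + s + q + 7) + 3).eval F.input.size)
      (F.input.count + 3) P F.input.start fun τ => Correct F τ.mem) :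
    SolvableInStronglyPolynomialTime (fun F : Factorized s q => F.input) Correct := by
  refine ⟨P, P.costPoly.comp (Polynomial.X + 3), 2 * growPoly (3 * q + s + q + 7) + 3, fun F => ?_⟩
  obtain ⟨t, τ, hE, ht, hτ⟩ := h F
  exact ⟨t, τ, hE, by simpa [Prog.eval_costPoly] using ht, hτ⟩

theorem solvable_nonzero (s q : ℕ) : SolvableInStronglyPolynomialTime
    (fun F : Factorized s q => F.input) (fun F m => F.Solved m) := by
  refine solvable_of_runs (solveNonzero s q) fun F => ?_
  refine (runs_solveNonzero F.bounds (fun _ _ => rfl) (fun _ hr => F.start_idx_of_le hr)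
    (fun _ k ha => F.start_mem_of_le k ha) (fun _ _ => rfl)
    (fun _ _ _ _ _ _ => by simp [Factorized.forms])).imp fun τ ⟨x, hx, hm, hy⟩ _ => ?_
  exact F.solved_of_objective_le hx hm hy

theorem solvable_atMost (s q : ℕ) (hs : 0 < s) : SolvableInStronglyPolynomialTime
    (fun F : Factorized s q => F.input) (fun F m => F.SolvedAtMost m) := by
  refine solvable_of_runs (solve s q) fun F => ?_
  refine (runs_solve hs F.bounds (fun _ _ => rfl) (fun _ hr => F.start_idx_of_le hr)
    (fun _ k ha => F.start_mem_of_le k ha) (fun _ _ => rfl)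
    (fun _ _ _ _ _ _ => by simp [Factorized.forms])).imp fun τ ⟨x, hx, hm, hy⟩ _ => ?_
  exact F.solvedAtMost_of_objective_le hs hx hm hy

end BoolTensor

/-- The same program and polynomials serve any subfamily of instances, in particular the rank
factorizations. -/
theorem StrongPoly.SolvableInStronglyPolynomialTime.comp {ι κ : Type} {enc : ι → Input}
    {Correct : ι → (ℕ → ℕ → ℚ) → Prop} (h : SolvableInStronglyPolynomialTime enc Correct)
    (f : κ → ι) : SolvableInStronglyPolynomialTime (fun x => enc (f x))
      (fun x m => Correct (f x) m) := by
  obtain ⟨P, T, B, h⟩ := h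
  exact ⟨P, T, B, fun x => h (f x)⟩

theorem mainTheorem4 (s q : ℕ) (hs : 0 < s) :
    (StrongPoly.SolvableInStronglyPolynomialTime
        (fun F : BoolTensor.Factorized s q => F.input)
        (fun F m => F.Solved m) ∧
      StrongPoly.SolvableInStronglyPolynomialTime
        (fun F : BoolTensor.Factorized s q => F.input)
        (fun F m => F.SolvedAtMost m)) ∧
    (StrongPoly.SolvableInStronglyPolynomialTime
        (fun F : {F : BoolTensor.Factorized s q // F.IsRankFactorization} => F.1.input)
        (fun F m => F.1.Solved m) ∧
      StrongPoly.SolvableInStronglyPolynomialTime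
        (fun F : {F : BoolTensor.Factorized s q // F.IsRankFactorization} => F.1.input)
        (fun F m => F.1.SolvedAtMost m)) :=
  ⟨⟨BoolTensor.solvable_nonzero s q, BoolTensor.solvable_atMost s q hs⟩,
    (BoolTensor.solvable_nonzero s q).comp Subtype.val,
    (BoolTensor.solvable_atMost s q hs).comp Subtype.val⟩
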